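/- **Setting.** A safe linear bandit problem on $\mathbb{R}^d$ consists of a compact convex set $\mathcal{X}$, an objective $\theta^*\in\mathbb{R}^d$, constraint vectors $a^1,\dots,a^{M}\in\mathbb{R}^d$ with $M=K+U$, and levels $\alpha^1,\dots,\alpha^M\in\mathbb{R}$. The learner knows $\mathcal{X}$, $a^1,\dots,a^K$ and all the levels; $\theta^*$ and $a^{K+1},\dots,a^{M}$ are hidden. Put $\mathcal{K}=\{x\in\mathcal{X}:\langle a^i,x\rangle\le\alpha^i,\ i\le K\}$ and $\mathcal{S}=\{x\in\mathcal{K}:\langle a^i,x\rangle\le\alpha^i,\ K<i\le M\}$, and let $x^*$ be the unique maximiser of $\langle\theta^*,x\rangle$ over $\mathcal{S}$. In round $t$ a (possibly randomised) algorithm picks $x_t\in\mathcal{K}$ on the basis of the public data and of the past actions and feedback, and then observes $r_t=\langle\theta^*,x_t\rangle+\gamma_t^0$ and $s_t^i=\langle a^i,x_t\rangle+\gamma^i_t$ for all $i\le M$, where all $\gamma^i_t$ are independent standard Gaussians. The regret is $$\mathrm{Regret}_T=\sum_{t=1}^T\max\Big(\langle\theta^*,x^*-x_t\rangle,\ \max_i(\langle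 a^i,x_t\rangle-\alpha^i)_+\Big).$$ **Gaps.** For $I\subset[1:M]$ with $|I|=d$ and $x\in\mathcal{K}$ write $I\sim x$ if $\langle a^i,x\rangle=\alpha^i$ for all $i\in I$. For $v\in\mathbb{R}^d$ and $J\subset[1:K]\setminus I$ let $$\operatorname{spread}(v;I,J)=\inf\{1+\|\pi\|_1\},$$ where the infimum is over the $\pi$-parts of the minimisers $(\pi,\rho,\sigma)$ of $\sum_{i\in I,\,i>K}\pi_i\alpha^i+\sum_{i\in I,\,i\le K}\rho_i\alpha^i+\sum_{j\in J}\sigma_j\alpha^j$ subject to $\sum_{i\in I,\,i>K}\pi_ia^i+\sum_{i\in I,\,i\le K}\rho_ia^i+\sum_{j\in J}\sigma_ja^j=v$ and $\sigma\ge0$. Put $$\Delta_I=\frac{\max\big(0,\inf_{x\sim I}\langle\theta^*,x^*-x\rangle\big)}{\operatorname{spread}(\theta^*;I,[1:K]\setminus I)},\qquad \Gamma_I=\max_{k\notin I}\frac{\inf_{x\sim I}\langle a^k,x\rangle-\alpha^k}{\operatorname{spread}(-a^k;I,[1:K]\setminus(I\cup\{k\}))}.$$ **Theorem.** There are absolute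 constants $g,c>0$ such that for all integers $d\ge1$ and $T\ge1$ there are $\mathcal{X}$ contained in the unit ball, known constraints $a^1,\dots,a^K$ and levels $\alpha^1,\dots,\alpha^M$ for which $\mathcal{K}$ is exactly the solution set of the known constraints and is an axis-parallel box with non-empty interior, and such that for every algorithm there is a choice of the hidden vectors $\theta^*,a^{K+1},\dots,a^M$ for which * $\|\theta^*\|\le1$ and $\|a^i\|\le1$ for all $i$, there is a unique optimum $x^*$, and every vertex of $\{x:\langle a^i,x\rangle\le\alpha^i,\ i\le M\}$ is non-degenerate (exactly $d$ constraints are active there); * every extreme point $x\ne x^*$ of $\mathcal{K}$ or of $\mathcal{S}$ has gap at least $g$: $\max(\Delta_I,\Gamma_I)\ge g$ for every $I\sim x$ with $|I|=d$; * $\mathbb{E}[\mathrm{Regret}_T]\ge c\,\min(d\sqrt{T},T)$. In particular, $\mathbb{E}[\mathrm{Regret}_T]\ge c\,d\sqrt T$ whenever $T\ge d^2$. -/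

import Mathlib

open MeasureTheory ProbabilityTheory
open scoped ENNReal

noncomputable section

namespace SafeBandit

/-- What the learner is told in a safe linear bandit problem on `ℝ^d`: the compact convex set `X`,
the `K` known constraint vectors, and the levels of all `K + U` constraints. Known constraints are
indexed by `Sum.inl`, unknown ones by `Sum.inr`. -/
structure PublicData (d : ℕ) where
  K : ℕ
  U : ℕ
  X : Set (EuclideanSpace ℝ (Fin d))
  knownVec : Fin K → EuclideanSpace ℝ (Fin d)
  level : Fin K ⊕ Fin U → ℝ

/-- What is hidden from the learner: the objective and the unknown constraint vectors. -/
structure Hidden {d : ℕ} (P : PublicData d) where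
  θ : EuclideanSpace ℝ (Fin d)
  unknownVec : Fin P.U → EuclideanSpace ℝ (Fin d)

variable {d : ℕ}

/-- The index set of all `M = K + U` constraints. -/
abbrev PublicData.Idx (P : PublicData d) : Type := Fin P.K ⊕ Fin P.U

/-- The known domain `𝒦`. -/
def PublicData.knownDomain (P : PublicData d) : Set (EuclideanSpace ℝ (Fin d)) :=
  {x | x ∈ P.X ∧ ∀ i : Fin P.K, inner ℝ (P.knownVec i) x ≤ P.level (Sum.inl i)}

/-- `𝒦` is the solution set of the known linear constraints (so it is a polytope when bounded). -/
def PublicData.IsPolytopal (P : PublicData d) : Prop :=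
  P.knownDomain = {x | ∀ i : Fin P.K, inner ℝ (P.knownVec i) x ≤ P.level (Sum.inl i)}

/-- `𝒦` is an axis-parallel box with non-empty interior. -/
def PublicData.IsBox (P : PublicData d) : Prop :=
  ∃ lo hi : Fin d → ℝ, (∀ j, lo j < hi j) ∧
    P.knownDomain = {x | ∀ j, lo j ≤ x j ∧ x j ≤ hi j}

/-- The objective value of the program `Π(v; L, M)` at `(π, ρ, σ)`. -/
def PublicData.dualValue (P : PublicData d)
    (π : Fin P.U → ℝ) (ρ σ : Fin P.K → ℝ) : ℝ :=
  ∑ j, π j * P.level (Sum.inr j) + ∑ j, ρ j * P.level (Sum.inl j)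
    + ∑ j, σ j * P.level (Sum.inl j)

namespace Hidden

variable {P : PublicData d} (H : Hidden P)

/-- The constraint vectors `a^i`, `i ∈ [1:M]`. -/
def vec : P.Idx → EuclideanSpace ℝ (Fin d) :=
  Sum.elim P.knownVec H.unknownVec

/-- The feasible set `𝒮`. -/
def feasibleSet : Set (EuclideanSpace ℝ (Fin d)) :=
  {x | x ∈ P.knownDomain ∧
    ∀ i : Fin P.U, inner ℝ (H.unknownVec i) x ≤ P.level (Sum.inr i)}

/-- `xs` is the unique optimal feasible solution `x^*`. -/
def IsUniqueOptimum (xs : EuclideanSpace ℝ (Fin d)) : Prop :=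
  xs ∈ H.feasibleSet ∧ ∀ y ∈ H.feasibleSet, y ≠ xs → inner ℝ H.θ y < inner ℝ H.θ xs

/-- All basic feasible solutions (vertices) of `A x ≤ α` are non-degenerate: exactly `d`
constraints are active there. -/
def IsNondegenerate : Prop :=
  ∀ x ∈ {x | ∀ i : P.Idx, inner ℝ (H.vec i) x ≤ P.level i}.extremePoints ℝ,
    {i : P.Idx | inner ℝ (H.vec i) x = P.level i}.ncard = d

/-! ### Basic index sets and gaps -/

/-- Association `I ∼ x` of a set of constraints with a point of `𝒦`. -/
def Associated (I : Finset P.Idx) (x : EuclideanSpace ℝ (Fin d)) : Prop :=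
  x ∈ P.knownDomain ∧ ∀ i ∈ I, inner ℝ (H.vec i) x = P.level i

/-- Feasibility of `(π, ρ, σ)` for the linear program `Π(v; L, M)`. The vectors indexed by
`L ∩ [K+1:M]`, `L ∩ [1:K]` and `M` are written as vectors that vanish off these sets. -/
def DualFeasible (v : EuclideanSpace ℝ (Fin d)) (L : Finset P.Idx) (M : Finset (Fin P.K))
    (π : Fin P.U → ℝ) (ρ σ : Fin P.K → ℝ) : Prop :=
  (∀ j, Sum.inr j ∉ L → π j = 0) ∧ (∀ j, Sum.inl j ∉ L → ρ j = 0) ∧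
  (∀ j, j ∉ M → σ j = 0) ∧ (∀ j, 0 ≤ σ j) ∧
  ∑ j, π j • H.unknownVec j + ∑ j, ρ j • P.knownVec j + ∑ j, σ j • P.knownVec j = v

/-- `(π, ρ, σ)` optimises (minimises) the program `Π(v; L, M)`. -/
def DualOptimal (v : EuclideanSpace ℝ (Fin d)) (L : Finset P.Idx) (M : Finset (Fin P.K))
    (π : Fin P.U → ℝ) (ρ σ : Fin P.K → ℝ) : Prop :=
  H.DualFeasible v L M π ρ σ ∧
    ∀ π' ρ' σ', H.DualFeasible v L M π' ρ' σ' → P.dualValue π ρ σ ≤ P.dualValue π' ρ' σ'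

/-- `spread(v; L, M) = inf {1 + ‖π‖₁}` over the optimisers `(π, ρ, σ)` of `Π(v; L, M)`. -/
def spread (v : EuclideanSpace ℝ (Fin d)) (L : Finset P.Idx) (M : Finset (Fin P.K)) : ℝ :=
  sInf {z | ∃ π ρ σ, H.DualOptimal v L M π ρ σ ∧ z = 1 + ∑ j, |π j|}

open Classical in
/-- The efficiency gap `Δ_I`, where `xs` stands for `x^*`. The separation in the numerator is that
of the points associated with `I` that come closest to the optimal value. -/
def effGap (xs : EuclideanSpace ℝ (Fin d)) (I : Finset P.Idx) : ℝ :=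
  max 0 (sInf {z | ∃ x, H.Associated I x ∧ z = inner ℝ H.θ (xs - x)}) /
    H.spread H.θ I {j | Sum.inl j ∉ I}

/-- The feasibility separation `γ(I; k)`. -/
def feasSep (I : Finset P.Idx) (k : P.Idx) : ℝ :=
  sInf {z | ∃ x, H.Associated I x ∧ z = inner ℝ (H.vec k) x - P.level k}

open Classical in
/-- The feasibility gap `Γ_I`. -/
def feasGap (I : Finset P.Idx) : ℝ :=
  ⨆ k : {k : P.Idx // k ∉ I},
    H.feasSep I k.1 / H.spread (-H.vec k.1) I {j | Sum.inl j ∉ I ∧ Sum.inl j ≠ k.1}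

/-- Every extreme point of `𝒦` and of `𝒮`, other than the optimum `xs`, has gap at least `g`:
every basic index set (`d` constraints) associated with it has efficiency gap or feasibility gap at
least `g`. Such index sets are consistent, so the consistency gap plays no role for them. -/
def ExtremePointGap (xs : EuclideanSpace ℝ (Fin d)) (g : ℝ) : Prop :=
  ∀ x ∈ P.knownDomain.extremePoints ℝ ∪ H.feasibleSet.extremePoints ℝ, x ≠ xs →
    ∀ I : Finset P.Idx, I.card = d → H.Associated I x → g ≤ max (H.effGap xs I) (H.feasGap I)

/-! ### Regret -/

/-- The regret `max(⟨θ^*, x^* - x⟩, max_i (⟨a^i, x⟩ - α^i)_+)` of the action `x` in one round. -/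
def instRegret (xs x : EuclideanSpace ℝ (Fin d)) : ℝ :=
  max (inner ℝ H.θ (xs - x)) (⨆ i : P.Idx, max (inner ℝ (H.vec i) x - P.level i) 0)

end Hidden

/-! ### Play -/

/-- The feedback of a round: the noisy reward and the noisy values of all constraints. -/
abbrev PublicData.Feedback (P : PublicData d) : Type := ℝ × (P.Idx → ℝ)

/-- The record of a round: the action and the feedback. -/
abbrev PublicData.Round (P : PublicData d) : Type := EuclideanSpace ℝ (Fin d) × P.Feedback

/-- A (possibly randomised) algorithm: given the record of the first `t` rounds it chooses the
distribution of the next action, which lies in `𝒦`. It may depend on all public data. -/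
structure Algorithm (P : PublicData d) where
  select : (t : ℕ) → Kernel (Fin t → P.Round) (EuclideanSpace ℝ (Fin d))
  markov : ∀ t, IsMarkovKernel (select t)
  mem_knownDomain : ∀ t h, ∀ᵐ x ∂(select t h), x ∈ P.knownDomain

instance {P : PublicData d} (A : Algorithm P) (t : ℕ) : IsMarkovKernel (A.select t) := A.markov t

/-- The noise of a round: independent standard Gaussians for the reward and each constraint. -/
def PublicData.noise (P : PublicData d) : Measure P.Feedback :=
  (gaussianReal 0 1).prod (Measure.pi fun _ => gaussianReal 0 1)

instance (P : PublicData d) : IsProbabilityMeasure P.noise := by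
  unfold PublicData.noise; infer_instance

namespace Hidden

variable {P : PublicData d} (H : Hidden P)

/-- The feedback `r = ⟨θ^*, x⟩ + γ^0`, `s^i = ⟨a^i, x⟩ + γ^i` to the action `x` under noise `γ`. -/
def observe (x : EuclideanSpace ℝ (Fin d)) (γ : P.Feedback) : P.Feedback :=
  (inner ℝ H.θ x + γ.1, fun i => inner ℝ (H.vec i) x + γ.2 i)

theorem measurable_observe : Measurable (Function.uncurry H.observe) := by
  unfold Function.uncurry observe
  refine Measurable.prodMk (by fun_prop) (measurable_pi_lambda _ fun i => by fun_prop)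

/-- The conditional law of the feedback given the action. -/
def feedback : Kernel (EuclideanSpace ℝ (Fin d)) P.Feedback where
  toFun x := P.noise.map (H.observe x)
  measurable' := by
    refine Measure.measurable_of_measurable_coe _ fun s hs => ?_
    have h (x : EuclideanSpace ℝ (Fin d)) : P.noise.map (H.observe x) s
        = P.noise (Prod.mk x ⁻¹' (Function.uncurry H.observe ⁻¹' s)) :=
      Measure.map_apply (H.measurable_observe.comp measurable_prodMk_left) hs
    simp only [h]
    exact measurable_measure_prodMk_left (H.measurable_observe hs)

instance : IsMarkovKernel H.feedback where
  isProbabilityMeasure _ :=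
    Measure.isProbabilityMeasure_map
      (H.measurable_observe.comp measurable_prodMk_left).aemeasurable

/-- The law of the record of the first `n` rounds when `A` is played. -/
def law (A : Algorithm P) : (n : ℕ) → Measure (Fin n → P.Round)
  | 0 => Measure.dirac Fin.elim0
  | n + 1 =>
    (law A n ⊗ₘ (A.select n ⊗ₖ Kernel.prodMkLeft (Fin n → P.Round) H.feedback)).map
      (fun p => (Fin.snoc p.1 p.2 : Fin (n + 1) → P.Round))

theorem measurable_snoc (n : ℕ) :
    Measurable fun p : (Fin n → P.Round) × P.Round =>
      (Fin.snoc p.1 p.2 : Fin (n + 1) → P.Round) := by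
  refine measurable_pi_lambda _ fun i => ?_
  refine Fin.lastCases ?_ (fun j => ?_) i
  · simpa using measurable_snd
  · simp only [Fin.snoc_castSucc]
    exact (measurable_pi_apply j).comp measurable_fst

instance isProbabilityMeasure_law (A : Algorithm P) (n : ℕ) :
    IsProbabilityMeasure (H.law A n) := by
  induction n with
  | zero => unfold law; infer_instance
  | succ n ih =>
    unfold law
    exact Measure.isProbabilityMeasure_map (measurable_snoc n).aemeasurable

/-- The expectation of `Regret_T` when `A` is played, where `xs` stands for `x^*`. -/
def expectedRegret (xs : EuclideanSpace ℝ (Fin d)) (A : Algorithm P) (T : ℕ) : ℝ :=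
  ∫ h, ∑ t : Fin T, H.instRegret xs (h t).1 ∂(H.law A T)

end Hidden

end SafeBandit

end

open MeasureTheory ProbabilityTheory
open scoped ENNReal

noncomputable section

namespace SafeBandit

/-! ### A chi-square bound between measures -/

/-! Hide one sign per coordinate and let the signal size `δ` be a small multiple of `min (1/√T)
(1/d)`. Flipping one sign moves the mean feedback of a round by `O(δ)` in Euclidean norm
(`sq_dist_observe_le`), whatever the action in the known domain. So the laws of the whole record
before and after the flip have a likelihood ratio whose second moment is close to 1
(`chiSqBound_law`), and a statistic with values in `[0, 1]` shifts its mean by at most `1/8`.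
Averaging over all signs (`exists_signs_of_flip_le`), some sign vector is poorly correlated with the
play. An action pays of order `δ` for each coordinate in which its correlation is missing
(`score_le_instRegret`), so the regret is of order `d T δ`, that is, `min (d√T) T`.

The geometry has to reconcile this with gaps bounded below. The feasible set is a thin pyramid over
a simplex, with its apex at the optimum and its base on the known face `x 0 = 1/4`. Its other
vertices lie on the base and lose a constant reward. The axis of the pyramid encodes the signs, but
its facets are scaled down by `coneScale`, which leaves the set unchanged and makes them nearly mute
in the feedback. Regret is forced instead by two constraints that are slack on the feasible set and
so create no vertices of it. The cap, played against the lost reward, hides the sign of direction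
`0`. The alignment constraint asks for correlation with all other signs.

At a corner of the box no unknown constraint is active (`unknown_inactive`), so a basic index set
has to contain one of the two known faces orthogonal to the objective. The objective and the cap
vector are multiples of the normals of these faces, hence have spread 1, and each gap in
`extremePointGap` is bounded below by a plain separation. -/

theorem sq_lintegral_mul_le {α : Type*} [MeasurableSpace α] (μ : Measure α) {f g : α → ℝ≥0∞}
    (hf : Measurable f) (hg : Measurable g) :
    (∫⁻ a, f a * g a ∂μ) ^ 2 ≤ (∫⁻ a, f a ^ 2 ∂μ) * ∫⁻ a, g a ^ 2 ∂μ := by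
  have h := ENNReal.lintegral_mul_le_Lp_mul_Lq μ (p := 2) (q := 2)
    Real.HolderConjugate.two_two hf.aemeasurable hg.aemeasurable
  simp only [Pi.mul_apply, ENNReal.rpow_two] at h
  have sq_rpow (z : ℝ≥0∞) : (z ^ (1 / 2 : ℝ)) ^ 2 = z := by
    rw [← ENNReal.rpow_natCast, ← ENNReal.rpow_mul]; norm_num
  calc _ ≤ _ := pow_le_pow_left' h 2
    _ = _ := by rw [mul_pow, sq_rpow, sq_rpow]

theorem sq_lintegral_le {α : Type*} [MeasurableSpace α] (μ : Measure α) [IsProbabilityMeasure μ]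
    {f : α → ℝ≥0∞} (hf : Measurable f) : (∫⁻ a, f a ∂μ) ^ 2 ≤ ∫⁻ a, f a ^ 2 ∂μ := by
  simpa using sq_lintegral_mul_le μ hf (measurable_const (a := (1 : ℝ≥0∞)))

/-- The second moment under `P` of the likelihood ratio of `Q` to `P` is at most `C`, in dual
form. -/
def ChiSqBound {α : Type*} [MeasurableSpace α] (P Q : Measure α) (C : ℝ≥0∞) : Prop :=
  ∀ f : α → ℝ≥0∞, Measurable f → (∫⁻ a, f a ∂Q) ^ 2 ≤ C * ∫⁻ a, f a ^ 2 ∂P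

theorem ChiSqBound.mono {α : Type*} [MeasurableSpace α] {P Q : Measure α} {C D : ℝ≥0∞}
    (h : ChiSqBound P Q C) (hCD : C ≤ D) : ChiSqBound P Q D := fun f hf =>
  (h f hf).trans (by gcongr)

theorem ChiSqBound.prod {α β : Type*} [MeasurableSpace α] [MeasurableSpace β]
    {P Q : Measure α} {P' Q' : Measure β} {C C' : ℝ≥0∞} [SFinite P'] [SFinite Q']
    (h : ChiSqBound P Q C) (h' : ChiSqBound P' Q' C') :
    ChiSqBound (P.prod P') (Q.prod Q') (C * C') := by
  intro f hf
  rw [lintegral_prod _ hf.aemeasurable, lintegral_prod _ (hf.pow_const 2).aemeasurable]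
  refine (h _ hf.lintegral_prod_right').trans ?_
  rw [mul_assoc, ← lintegral_const_mul _ (hf.pow_const 2).lintegral_prod_right']
  gcongr with a
  exact h' _ (hf.comp measurable_prodMk_left)

/-- Coordinates are integrated out one at a time through `lmarginal`, and each contributes its
factor. -/
theorem ChiSqBound.pi {ι : Type*} [Fintype ι] {P Q : ι → Measure ℝ} {C : ι → ℝ≥0∞}
    [∀ i, SigmaFinite (P i)] [∀ i, SigmaFinite (Q i)] (h : ∀ i, ChiSqBound (P i) (Q i) (C i)) :
    ChiSqBound (Measure.pi P) (Measure.pi Q) (∏ i, C i) := by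
  classical
  intro f hf
  have key (s : Finset ι) (x : ι → ℝ) :
      ((∫⋯∫⁻_s, f ∂Q) x) ^ 2 ≤ (∏ i ∈ s, C i) * (∫⋯∫⁻_s, (fun y => f y ^ 2) ∂P) x := by
    induction s using Finset.induction_on generalizing x with
    | empty => simp
    | insert i s hi ih =>
      have hm : Measurable fun z => (∫⋯∫⁻_s, (fun y => f y ^ 2) ∂P) (Function.update x i z) :=
        ((hf.pow_const 2).lmarginal P).comp (measurable_update x)
      rw [lmarginal_insert _ hf hi, lmarginal_insert _ (hf.pow_const 2) hi,
        Finset.prod_insert hi, mul_assoc, ← lintegral_const_mul _ hm]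
      refine (h i _ ((hf.lmarginal Q).comp (measurable_update x))).trans ?_
      gcongr with a
      exact ih _
  rw [lintegral_eq_lmarginal_univ 0, lintegral_eq_lmarginal_univ 0]
  exact key Finset.univ 0

/-- Let `p_a`, `p_b` be the two densities. Cauchy–Schwarz for Lebesgue measure is applied to `f
√p_a` and `p_b / √p_a`. Completing the square shows that `p_b ^ 2 / p_a` is `exp ((b - a) ^ 2)`
times the Gaussian density with mean `2 b - a`. -/
theorem chiSqBound_gaussianReal (a b : ℝ) :
    ChiSqBound (gaussianReal a 1) (gaussianReal b 1) (ENNReal.ofReal (Real.exp ((b - a) ^ 2))) := by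
  intro f hf
  set φ : ℝ → ℝ := fun x => Real.sqrt (gaussianPDFReal a 1 x) with hφ
  have hpos (c x : ℝ) : 0 < gaussianPDFReal c 1 x := gaussianPDFReal_pos c 1 x one_ne_zero
  have hφpos (x : ℝ) : 0 < φ x := Real.sqrt_pos.2 (hpos a x)
  have hφm : Measurable φ := (measurable_gaussianPDFReal a 1).sqrt
  set F : ℝ → ℝ≥0∞ := fun x => f x * ENNReal.ofReal (φ x)
  set G : ℝ → ℝ≥0∞ := fun x => ENNReal.ofReal (gaussianPDFReal b 1 x / φ x)
  have hF : Measurable F := hf.mul hφm.ennreal_ofReal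
  have hG : Measurable G := ((measurable_gaussianPDFReal b 1).div hφm).ennreal_ofReal
  have e1 : ∫⁻ x, f x ∂(gaussianReal b 1) = ∫⁻ x, F x * G x := by
    rw [gaussianReal_of_var_ne_zero _ one_ne_zero,
      lintegral_withDensity_eq_lintegral_mul _ (measurable_gaussianPDF b 1) hf]
    refine lintegral_congr fun x => ?_
    simp only [Pi.mul_apply, F, G, gaussianPDF]
    rw [mul_assoc, ← ENNReal.ofReal_mul (hφpos x).le, mul_div_cancel₀ _ (hφpos x).ne', mul_comm]
  have e2 : ∫⁻ x, f x ^ 2 ∂(gaussianReal a 1) = ∫⁻ x, F x ^ 2 := by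
    rw [gaussianReal_of_var_ne_zero _ one_ne_zero,
      lintegral_withDensity_eq_lintegral_mul _ (measurable_gaussianPDF a 1) (hf.pow_const 2)]
    refine lintegral_congr fun x => ?_
    simp only [Pi.mul_apply, F, gaussianPDF]
    rw [mul_pow, ← ENNReal.ofReal_pow (hφpos x).le, hφ, Real.sq_sqrt (hpos a x).le, mul_comm]
  have e3 : ∫⁻ x, G x ^ 2 = ENNReal.ofReal (Real.exp ((b - a) ^ 2)) := by
    have (x : ℝ) : G x ^ 2
        = ENNReal.ofReal (Real.exp ((b - a) ^ 2)) * gaussianPDF (2 * b - a) 1 x := by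
      simp only [G, gaussianPDF]
      rw [← ENNReal.ofReal_pow (div_nonneg (hpos b x).le (hφpos x).le),
        ← ENNReal.ofReal_mul (Real.exp_pos _).le, div_pow, hφ, Real.sq_sqrt (hpos a x).le]
      congr 1
      rw [div_eq_iff (hpos a x).ne']
      simp only [gaussianPDFReal]
      have : Real.exp (-(x - b) ^ 2 / (2 * (1 : NNReal))) ^ 2 = Real.exp ((b - a) ^ 2) *
          Real.exp (-(x - (2 * b - a)) ^ 2 / (2 * (1 : NNReal)))
            * Real.exp (-(x - a) ^ 2 / (2 * (1 : NNReal))) := by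
        rw [← Real.exp_add, ← Real.exp_add, ← Real.exp_nat_mul]
        congr 1
        push_cast
        ring
      rw [mul_pow, this]
      ring
    simp only [this]
    rw [lintegral_const_mul _ (measurable_gaussianPDF _ _), lintegral_gaussianPDF_eq_one _ one_ne_zero,
      mul_one]
  rw [e1, e2, ← e3, mul_comm (∫⁻ x, G x ^ 2)]
  exact sq_lintegral_mul_le _ hF hG

/-- Nearby measures give nearby expectations of a bounded function. -/
theorem ChiSqBound.integral_le {α : Type*} [MeasurableSpace α] {P Q : Measure α}
    [IsProbabilityMeasure P] [IsProbabilityMeasure Q]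
    (h : ChiSqBound P Q (ENNReal.ofReal (101 / 100))) {u : α → ℝ} (hu : Measurable u)
    (h0 : ∀ a, 0 ≤ u a) (h1 : ∀ a, u a ≤ 1) :
    ∫ a, u a ∂Q ≤ ∫ a, u a ∂P + 1 / 8 := by
  have hint (R : Measure α) [IsProbabilityMeasure R] : Integrable u R :=
    Integrable.of_bound hu.aestronglyMeasurable 1
      (ae_of_all _ fun a => by rw [Real.norm_of_nonneg (h0 a)]; exact h1 a)
  have hint2 : Integrable (fun a => u a ^ 2) P :=
    Integrable.of_bound (hu.pow_const 2).aestronglyMeasurable 1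
      (ae_of_all _ fun a => by
        rw [Real.norm_of_nonneg (sq_nonneg _)]; nlinarith [h0 a, h1 a])
  have hw (a : α) : 0 ≤ 1 + u a / 10 := by linarith [h0 a]
  have hwm : Measurable fun a => 1 + u a / 10 := by fun_prop
  -- Tested on a small perturbation of 1, the squares linearise. With `p` and `q` the means of `u`
  -- under `P` and `Q`, the bound reads `1 + q/5 ≤ 1.01 (1 + p/5)` up to second-order terms.
  have key := h (fun a => ENNReal.ofReal (1 + u a / 10)) hwm.ennreal_ofReal
  have hsq (a : α) : ENNReal.ofReal (1 + u a / 10) ^ 2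
      = ENNReal.ofReal (1 + u a / 5 + u a ^ 2 / 100) := by
    rw [← ENNReal.ofReal_pow (hw a)]; congr 1; ring
  simp only [hsq] at key
  rw [← ofReal_integral_eq_lintegral_ofReal (by fun_prop) (ae_of_all _ hw),
    ← ofReal_integral_eq_lintegral_ofReal (by fun_prop)
      (ae_of_all _ fun a => by have := h0 a; positivity),
    ← ENNReal.ofReal_pow (integral_nonneg hw), ← ENNReal.ofReal_mul (by norm_num)] at key
  have hP : ∫ a, (1 + u a / 5 + u a ^ 2 / 100) ∂P
      = 1 + (∫ a, u a ∂P) / 5 + (∫ a, u a ^ 2 ∂P) / 100 := by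
    rw [integral_add (by fun_prop) (by fun_prop), integral_add (by fun_prop) (by fun_prop),
      integral_div, integral_div]; simp
  have hQ : ∫ a, (1 + u a / 10) ∂Q = 1 + (∫ a, u a ∂Q) / 10 := by
    rw [integral_add (by fun_prop) (by fun_prop), integral_div]; simp
  rw [hP, hQ] at key
  have hP0 : 0 ≤ ∫ a, u a ∂P := integral_nonneg h0
  have hP1 : ∫ a, u a ∂P ≤ 1 := by
    simpa using integral_mono (hint P) (integrable_const (1 : ℝ)) h1
  have hP2 : ∫ a, u a ^ 2 ∂P ≤ 1 := by
    simpa using integral_mono hint2 (integrable_const (1 : ℝ))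
      (fun a => by nlinarith [h0 a, h1 a])
  have hP20 : 0 ≤ ∫ a, u a ^ 2 ∂P := integral_nonneg fun a => sq_nonneg _
  rw [ENNReal.ofReal_le_ofReal_iff (by positivity)] at key
  nlinarith [sq_nonneg (∫ a, u a ∂Q)]

/-! ### The law of the record -/

variable {d : ℕ}

namespace Hidden

variable {P : PublicData d} (H : Hidden P)

theorem feedback_apply (x : EuclideanSpace ℝ (Fin d)) :
    H.feedback x = (gaussianReal (inner ℝ H.θ x) 1).prod
      (Measure.pi fun i => gaussianReal (inner ℝ (H.vec i) x) 1) := by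
  change P.noise.map (H.observe x) = _
  have h1 (y : ℝ) : (gaussianReal 0 1).map (fun z => y + z) = gaussianReal y 1 := by
    rw [gaussianReal_map_const_add, zero_add]
  have h2 : (Measure.pi fun _ : P.Idx => gaussianReal 0 1).map
      (fun γ i => inner ℝ (H.vec i) x + γ i)
      = Measure.pi fun i => gaussianReal (inner ℝ (H.vec i) x) 1 := by
    have (i : P.Idx) : SigmaFinite
        ((gaussianReal 0 1).map fun z => inner ℝ (H.vec i) x + z) := by
      rw [h1]; infer_instance
    rw [Measure.pi_map_pi (f := fun i z => inner ℝ (H.vec i) x + z)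
      (fun i => by fun_prop)]
    simp only [h1]
  rw [← h1, ← h2, Measure.map_prod_map _ _ (by fun_prop)
    (measurable_pi_lambda _ fun i => by fun_prop)]
  rfl

theorem chiSqBound_feedback (H' : Hidden P) (x : EuclideanSpace ℝ (Fin d)) {κ : ℝ}
    (hκ : (inner ℝ H'.θ x - inner ℝ H.θ x) ^ 2
      + ∑ i, (inner ℝ (H'.vec i) x - inner ℝ (H.vec i) x) ^ 2 ≤ κ) :
    ChiSqBound (H.feedback x) (H'.feedback x) (ENNReal.ofReal (Real.exp κ)) := by
  rw [feedback_apply, feedback_apply]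
  refine ((chiSqBound_gaussianReal _ _).prod
    (ChiSqBound.pi fun i => chiSqBound_gaussianReal _ _)).mono ?_
  rw [← ENNReal.ofReal_prod_of_nonneg fun i _ => (Real.exp_pos _).le, ← Real.exp_sum,
    ← ENNReal.ofReal_mul (Real.exp_pos _).le, ← Real.exp_add]
  exact ENNReal.ofReal_le_ofReal (Real.exp_le_exp.2 hκ)

theorem lintegral_law_succ (A : Algorithm P) (n : ℕ) {f : (Fin (n + 1) → P.Round) → ℝ≥0∞}
    (hf : Measurable f) :
    ∫⁻ h, f h ∂(H.law A (n + 1)) =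
      ∫⁻ h, ∫⁻ x, ∫⁻ y, f (Fin.snoc h (x, y)) ∂(H.feedback x) ∂(A.select n h) ∂(H.law A n) := by
  have hs := measurable_snoc (P := P) n
  have h1 : Measurable fun p : (Fin n → P.Round) × P.Round =>
      f (Fin.snoc p.1 p.2 : Fin (n + 1) → P.Round) := hf.comp hs
  rw [law, lintegral_map hf hs, Measure.lintegral_compProd h1]
  refine lintegral_congr fun h => ?_
  have h2 : Measurable fun p : P.Round => f (Fin.snoc h p : Fin (n + 1) → P.Round) :=
    h1.comp measurable_prodMk_left
  rw [Kernel.lintegral_compProd _ _ _ h2]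
  rfl

/-- Each round costs one factor `exp κ`. The algorithm selects by the same kernel under both
hypotheses, so its own randomisation costs nothing (`sq_lintegral_le`). Adaptivity is harmless
because `κ` is uniform over the known domain, where the action lies almost surely. -/
theorem chiSqBound_law (H' : Hidden P) (A : Algorithm P) {κ : ℝ}
    (hκ : ∀ x ∈ P.knownDomain, (inner ℝ H'.θ x - inner ℝ H.θ x) ^ 2
      + ∑ i, (inner ℝ (H'.vec i) x - inner ℝ (H.vec i) x) ^ 2 ≤ κ) (n : ℕ) :
    ChiSqBound (H.law A n) (H'.law A n) (ENNReal.ofReal (Real.exp (n * κ))) := by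
  induction n with
  | zero =>
    intro f hf
    simp only [law]
    rw [lintegral_dirac' _ hf, lintegral_dirac' _ (hf.pow_const 2)]
    simp
  | succ n ih =>
    intro f hf
    have hs := measurable_snoc (P := P) n
    have m1 (K : Hidden P) {g : (Fin (n + 1) → P.Round) → ℝ≥0∞} (hg : Measurable g) :
        Measurable fun p : (Fin n → P.Round) × EuclideanSpace ℝ (Fin d) =>
          ∫⁻ y, g (Fin.snoc p.1 (p.2, y)) ∂(K.feedback p.2) := by
      have : Measurable (Function.uncurry fun (p : (Fin n → P.Round) × EuclideanSpace ℝ (Fin d))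
          (y : P.Feedback) => g (Fin.snoc p.1 (p.2, y))) :=
        hg.comp (hs.comp (f := fun q : ((Fin n → P.Round) × EuclideanSpace ℝ (Fin d)) ×
          P.Feedback => (q.1.1, ((q.1.2, q.2) : P.Round))) (by fun_prop))
      exact this.lintegral_kernel_prod_right (κ := Kernel.prodMkLeft _ K.feedback)
    have m2 (K : Hidden P) {g : (Fin (n + 1) → P.Round) → ℝ≥0∞} (hg : Measurable g) :
        Measurable fun h : Fin n → P.Round =>
          ∫⁻ x, ∫⁻ y, g (Fin.snoc h (x, y)) ∂(K.feedback x) ∂(A.select n h) :=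
      Measurable.lintegral_kernel_prod_right (f := fun h x =>
        ∫⁻ y, g (Fin.snoc h (x, y)) ∂(K.feedback x)) (m1 K hg)
    rw [lintegral_law_succ _ _ _ hf, lintegral_law_succ _ _ _ (hf.pow_const 2)]
    refine (ih _ (m2 H' hf)).trans ?_
    have hexp : ENNReal.ofReal (Real.exp ((n + 1 : ℕ) * κ))
        = ENNReal.ofReal (Real.exp (n * κ)) * ENNReal.ofReal (Real.exp κ) := by
      rw [← ENNReal.ofReal_mul (Real.exp_pos _).le, ← Real.exp_add]
      push_cast
      congr 2
      ring
    rw [hexp, mul_assoc, ← lintegral_const_mul _ (m2 H (hf.pow_const 2))]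
    gcongr with h
    have m3 (K : Hidden P) {g : (Fin (n + 1) → P.Round) → ℝ≥0∞} (hg : Measurable g) :
        Measurable fun x => ∫⁻ y, g (Fin.snoc h (x, y)) ∂(K.feedback x) :=
      (m1 K hg).comp measurable_prodMk_left
    refine (sq_lintegral_le _ (m3 H' hf)).trans ?_
    rw [← lintegral_const_mul _ (m3 H (hf.pow_const 2))]
    refine lintegral_mono_ae ?_
    filter_upwards [A.mem_knownDomain n h] with x hx
    exact H.chiSqBound_feedback H' x (hκ x hx) _
      (hf.comp (hs.comp (measurable_const.prodMk (measurable_const.prodMk measurable_id))))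

theorem ae_law_mem_knownDomain (A : Algorithm P) (hP : MeasurableSet P.knownDomain) (n : ℕ) :
    ∀ᵐ h ∂(H.law A n), ∀ t, (h t).1 ∈ P.knownDomain := by
  induction n with
  | zero => exact ae_of_all _ fun _ t => t.elim0
  | succ n ih =>
    have hm (k : ℕ) : MeasurableSet {h : Fin k → P.Round | ∀ t, (h t).1 ∈ P.knownDomain} := by
      simp only [Set.ofPred_forall]
      exact MeasurableSet.iInter fun t => hP.preimage (by fun_prop)
    have hm' := (hm (n + 1)).preimage (measurable_snoc n)
    rw [law, ae_map_iff (measurable_snoc n).aemeasurable (hm _)]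
    refine Measure.ae_compProd_of_ae_ae hm' ?_
    filter_upwards [ih] with h hh
    refine Kernel.ae_compProd_of_ae_ae
      (hm'.preimage measurable_prodMk_left) ?_
    filter_upwards [A.mem_knownDomain n h] with x hx
    refine ae_of_all _ fun y t => ?_
    refine Fin.lastCases ?_ (fun j => ?_) t
    · simpa using hx
    · simpa using hh j

end Hidden

/-! ### The hard instance -/

variable {m : ℕ}

/-- The vector with first coordinate `a` and remaining coordinates `b`. -/
def consVec (a : ℝ) (b : Fin m → ℝ) : EuclideanSpace ℝ (Fin (m + 1)) :=
  WithLp.toLp 2 (Fin.cons a b : Fin (m + 1) → ℝ)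

@[simp] theorem consVec_zero (a : ℝ) (b : Fin m → ℝ) : consVec a b 0 = a := rfl

@[simp] theorem consVec_succ (a : ℝ) (b : Fin m → ℝ) (j : Fin m) : consVec a b j.succ = b j := rfl

theorem inner_consVec (a : ℝ) (b : Fin m → ℝ) (x : EuclideanSpace ℝ (Fin (m + 1))) :
    inner ℝ (consVec a b) x = a * x 0 + ∑ j, b j * x j.succ := by
  simp [PiLp.inner_apply, Fin.sum_univ_succ, mul_comm]

theorem norm_sq_consVec (a : ℝ) (b : Fin m → ℝ) : ‖consVec a b‖ ^ 2 = a ^ 2 + ∑ j, b j ^ 2 := by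
  simp [EuclideanSpace.norm_sq_eq, Fin.sum_univ_succ]

theorem norm_consVec_le (a : ℝ) (b : Fin m → ℝ) : ‖consVec a b‖ ≤ |a| + ∑ j, |b j| := by
  have h0 : 0 ≤ ∑ j, |b j| := Finset.sum_nonneg fun _ _ => abs_nonneg _
  refine abs_le_of_sq_le_sq' ?_ (by positivity) |>.2
  have : ∑ j, b j ^ 2 ≤ (∑ j, |b j|) ^ 2 := by
    simpa using Finset.sum_sq_le_sq_sum_of_nonneg (s := Finset.univ) (f := fun j => |b j|)
      fun _ _ => abs_nonneg _
  rw [norm_sq_consVec]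
  nlinarith [sq_abs a, mul_nonneg (abs_nonneg a) h0]

/-- The sign of a bit. -/
def sgn (b : Bool) : ℝ := if b then 1 else -1

theorem sgn_sq (b : Bool) : sgn b * sgn b = 1 := by cases b <;> simp [sgn]

theorem abs_sgn (b : Bool) : |sgn b| = 1 := by cases b <;> simp [sgn]

theorem sgn_not (b : Bool) : sgn (!b) = -sgn b := by cases b <;> simp [sgn]

/-- Half the side of the box in all directions but the first. -/
def halfSide (m : ℕ) : ℝ := 1 / (2 * √(m + 1))

theorem halfSide_pos (m : ℕ) : 0 < halfSide m := by unfold halfSide; positivity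

theorem halfSide_sq (m : ℕ) : (m + 1) * halfSide m ^ 2 = 1 / 4 := by
  have : (√((m : ℝ) + 1)) ^ 2 = m + 1 := Real.sq_sqrt (by positivity)
  unfold halfSide
  rw [div_pow, mul_pow, this]
  field_simp
  norm_num

theorem halfSide_le (m : ℕ) : halfSide m ≤ 1 / 2 := by
  have h1 := halfSide_sq m
  have h2 := halfSide_pos m
  have : (0 : ℝ) ≤ m := m.cast_nonneg
  nlinarith [mul_nonneg this (sq_nonneg (halfSide m))]

/-- The width of the cone that cuts out the feasible set. -/
def aperture (m : ℕ) : ℝ := halfSide m / (16 * (m + 1))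

theorem aperture_pos (m : ℕ) : 0 < aperture m := by
  have := halfSide_pos m
  unfold aperture; positivity

theorem aperture_mul (m : ℕ) : (m + 1) * aperture m = halfSide m / 16 := by
  unfold aperture; field_simp

theorem aperture_le (m : ℕ) : aperture m ≤ halfSide m / 16 := by
  have h1 := aperture_mul m
  have h2 := aperture_pos m
  have : (0 : ℝ) ≤ m := m.cast_nonneg
  nlinarith [mul_nonneg this h2.le]

/-- The scale of the constraints that cut out the feasible set. -/
def coneScale (m : ℕ) (δ : ℝ) : ℝ := δ / (2 * (m + 1))

/-- The lower corner of the box. -/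
def boxLo (m : ℕ) : Fin (m + 1) → ℝ := Fin.cons (1 / 4) fun _ => -halfSide m

/-- The upper corner of the box. -/
def boxHi (m : ℕ) : Fin (m + 1) → ℝ := Fin.cons (3 / 4) fun _ => halfSide m

theorem boxLo_lt_boxHi (j : Fin (m + 1)) : boxLo m j < boxHi m j := by
  have := halfSide_pos m
  refine Fin.cases ?_ (fun j => ?_) j
  · simp only [boxLo, boxHi, Fin.cons_zero]; norm_num
  · simp only [boxLo, boxHi, Fin.cons_succ]; linarith

/-- The box. -/
def boxSet (m : ℕ) : Set (EuclideanSpace ℝ (Fin (m + 1))) :=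
  {x | ∀ j, boxLo m j ≤ x j ∧ x j ≤ boxHi m j}

theorem mem_boxSet {x : EuclideanSpace ℝ (Fin (m + 1))} : x ∈ boxSet m ↔
    (1 / 4 ≤ x 0 ∧ x 0 ≤ 3 / 4) ∧ ∀ j : Fin m, |x j.succ| ≤ halfSide m := by
  simp only [boxSet, Set.mem_ofPred_eq, Fin.forall_fin_succ, boxLo, boxHi, Fin.cons_zero,
    Fin.cons_succ, abs_le]

/-- The public data: the box, given by its faces, one constraint that caps the first coordinate,
one that asks for alignment with the hidden signs, and `m + 1` that form a cone. -/
def boxData (m : ℕ) (δ : ℝ) : PublicData (m + 1) where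
  K := (m + 1) + (m + 1)
  U := m + 1 + 1 + 1
  X := boxSet m
  knownVec := Fin.append (fun j => EuclideanSpace.single j 1) fun j => -EuclideanSpace.single j 1
  -- The `8 * δ` keeps the cap strictly slack on the feasible set. The `1 / 8` keeps the alignment
  -- constraint inactive at the corners of the box, where the aligned sum is an integer multiple of
  -- `halfSide m`; it also gives strict slack when `m = 0`.
  level := Sum.elim (Fin.append (boxHi m) fun j => -boxLo m j)
    (Fin.cons ((1 + 8 * δ) / 4) (Fin.cons (-(δ * (m / 4 - 1 / 8)))
      fun _ => coneScale m δ * aperture m))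

/-- The coefficients of the facets of a simplex. -/
def facetCoef : Fin (m + 1) → Fin m → ℝ := Fin.cons (fun _ => -1) fun j => Pi.single j 1

/-- The facets of a simplex as linear forms. -/
def facet (i : Fin (m + 1)) (y : Fin m → ℝ) : ℝ := ∑ j, facetCoef i j * y j

theorem facet_zero (y : Fin m → ℝ) : facet 0 y = -∑ j, y j := by
  simp [facet, facetCoef]

theorem facet_succ (j : Fin m) (y : Fin m → ℝ) : facet j.succ y = y j := by
  simp [facet, facetCoef, Pi.single_apply]

theorem facet_add_smul (i : Fin (m + 1)) (y z : Fin m → ℝ) (t : ℝ) :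
    facet i (fun j => y j + t * z j) = facet i y + t * facet i z := by
  simp only [facet, mul_add, Finset.sum_add_distrib, Finset.mul_sum]
  congr 1
  exact Finset.sum_congr rfl fun _ _ => by ring

theorem sum_facet (y : Fin m → ℝ) : ∑ i, facet i y = 0 := by
  simp [Fin.sum_univ_succ, facet_zero, facet_succ]

theorem nonneg_of_facet_le {z : Fin m → ℝ} {b : ℝ} (h : ∀ i, facet i z ≤ b) : 0 ≤ b := by
  have := Finset.sum_le_sum fun i (_ : i ∈ Finset.univ) => h i
  rw [sum_facet] at this
  simp only [Finset.sum_const, Finset.card_univ, Fintype.card_fin, nsmul_eq_mul] at this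
  exact (mul_nonneg_iff_of_pos_left (by positivity)).1 this

/-- The facet forms sum to zero, so an upper bound on all of them bounds each from below by `-m *
b`. The loss of a factor of order `m` is what the `m + 1` in `aperture` compensates. -/
theorem abs_le_of_facet_le {z : Fin m → ℝ} {b : ℝ} (h : ∀ i, facet i z ≤ b) (j : Fin m) :
    |z j| ≤ (m + 1) * b := by
  have hb := nonneg_of_facet_le h
  have h1 := Finset.single_le_sum (f := fun i => b - facet i z)
    (fun i _ => sub_nonneg.2 (h i)) (Finset.mem_univ j.succ)
  have h2 := h j.succ
  rw [Finset.sum_sub_distrib, sum_facet] at h1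
  simp only [Finset.sum_const, Finset.card_univ, Fintype.card_fin, nsmul_eq_mul, facet_succ] at h1 h2
  push_cast at h1
  have : (0 : ℝ) ≤ m := m.cast_nonneg
  rw [abs_le]
  constructor <;> nlinarith [mul_nonneg this hb]

/-- The inverse of the first coordinate of the optimum. -/
def slope (δ : ℝ) (v : Fin (m + 1) → Bool) : ℝ := 2 + 32 * δ * sgn (v 0)

/-- The direction of the optimum. -/
def tilt (v : Fin (m + 1) → Bool) (j : Fin m) : ℝ := 3 / 2 * halfSide m * sgn (v j.succ)

/-- The displacement of `x` from the axis of the cone. -/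
def offset (v : Fin (m + 1) → Bool) (x : EuclideanSpace ℝ (Fin (m + 1))) (j : Fin m) : ℝ :=
  x j.succ - x 0 * tilt v j

/-- The hidden vectors for the hidden signs `v`. -/
def signHidden (δ : ℝ) (v : Fin (m + 1) → Bool) : Hidden (boxData m δ) where
  θ := EuclideanSpace.single 0 1
  unknownVec := Fin.cons (consVec (slope δ v / 4) 0)
    (Fin.cons (consVec 0 fun j => -(δ / halfSide m * sgn (v j.succ)))
      fun i => coneScale m δ •
        consVec (aperture m * slope δ v - facet i (tilt v)) (facetCoef i))

/-! ### The constraints in coordinates, and the box -/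

section

variable {δ : ℝ}

/-- The upper face of the box in direction `j`. -/
def upperIdx (δ : ℝ) (j : Fin (m + 1)) : (boxData m δ).Idx := Sum.inl (Fin.castAdd (m + 1) j)
/-- The lower face of the box in direction `j`. -/
def lowerIdx (δ : ℝ) (j : Fin (m + 1)) : (boxData m δ).Idx := Sum.inl (Fin.natAdd (m + 1) j)
/-- The cap on the first coordinate. -/
def capIdx (m : ℕ) (δ : ℝ) : (boxData m δ).Idx := Sum.inr (0 : Fin (m + 1 + 1 + 1))
/-- The alignment constraint. -/
def alignIdx (m : ℕ) (δ : ℝ) : (boxData m δ).Idx := Sum.inr (Fin.succ (0 : Fin (m + 1 + 1)))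
/-- The facets of the cone. -/
def coneIdx (δ : ℝ) (i : Fin (m + 1)) : (boxData m δ).Idx := Sum.inr i.succ.succ

theorem forall_known {p : Fin (boxData m δ).K → Prop} :
    (∀ i, p i) ↔ (∀ j, p (Fin.castAdd (m + 1) j)) ∧ ∀ j, p (Fin.natAdd (m + 1) j) :=
  ⟨fun h => ⟨fun _ => h _, fun _ => h _⟩, fun h i => Fin.addCases h.1 h.2 i⟩

theorem forall_unknown {p : Fin (boxData m δ).U → Prop} :
    (∀ i, p i) ↔ p (0 : Fin (m + 1 + 1 + 1)) ∧ p (Fin.succ (0 : Fin (m + 1 + 1))) ∧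
      ∀ i : Fin (m + 1), p i.succ.succ := by
  refine ⟨fun h => ⟨h _, h _, fun _ => h _⟩, fun h i => ?_⟩
  refine Fin.cases h.1 (fun i => ?_) i
  exact Fin.cases h.2.1 h.2.2 i

theorem forall_idx {p : (boxData m δ).Idx → Prop} :
    (∀ i, p i) ↔ ((∀ j, p (upperIdx δ j)) ∧ ∀ j, p (lowerIdx δ j)) ∧
      p (capIdx m δ) ∧ p (alignIdx m δ) ∧ ∀ i, p (coneIdx δ i) := by
  rw [Sum.forall, forall_known, forall_unknown]; rfl

variable (v : Fin (m + 1) → Bool) (x : EuclideanSpace ℝ (Fin (m + 1)))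

theorem vec_upperIdx (j) :
    (signHidden δ v).vec (upperIdx δ j) = EuclideanSpace.single j 1 :=
  Fin.append_left (fun j => EuclideanSpace.single j (1 : ℝ))
    (fun j => -EuclideanSpace.single j (1 : ℝ)) j
theorem vec_lowerIdx (j) :
    (signHidden δ v).vec (lowerIdx δ j) = -EuclideanSpace.single j 1 :=
  Fin.append_right (fun j => EuclideanSpace.single j (1 : ℝ))
    (fun j => -EuclideanSpace.single j (1 : ℝ)) j
@[simp] theorem level_upperIdx (j) : (boxData m δ).level (upperIdx δ j) = boxHi m j :=
  Fin.append_left (boxHi m) (fun j => -boxLo m j) j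
@[simp] theorem level_lowerIdx (j) : (boxData m δ).level (lowerIdx δ j) = -boxLo m j :=
  Fin.append_right (boxHi m) (fun j => -boxLo m j) j
@[simp] theorem level_capIdx : (boxData m δ).level (capIdx m δ) = (1 + 8 * δ) / 4 := rfl
@[simp] theorem level_alignIdx :
    (boxData m δ).level (alignIdx m δ) = -(δ * (m / 4 - 1 / 8)) := rfl
@[simp] theorem level_coneIdx (i) :
    (boxData m δ).level (coneIdx δ i) = coneScale m δ * aperture m := rfl

theorem vec_capIdx : (signHidden δ v).vec (capIdx m δ) = consVec (slope δ v / 4) 0 := rfl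
theorem vec_alignIdx : (signHidden δ v).vec (alignIdx m δ) =
    consVec 0 fun j => -(δ / halfSide m * sgn (v j.succ)) := rfl
theorem vec_coneIdx (i) : (signHidden δ v).vec (coneIdx δ i) = coneScale m δ •
    consVec (aperture m * slope δ v - facet i (tilt v)) (facetCoef i) := rfl

@[simp] theorem inner_vec_upperIdx (j) : inner ℝ ((signHidden δ v).vec (upperIdx δ j)) x = x j := by
  simp [vec_upperIdx, EuclideanSpace.inner_single_left]
@[simp] theorem inner_vec_lowerIdx (j) :
    inner ℝ ((signHidden δ v).vec (lowerIdx δ j)) x = -x j := by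
  simp [vec_lowerIdx, EuclideanSpace.inner_single_left]
@[simp] theorem inner_vec_capIdx :
    inner ℝ ((signHidden δ v).vec (capIdx m δ)) x = slope δ v / 4 * x 0 := by
  simp [vec_capIdx, inner_consVec]
@[simp] theorem inner_vec_alignIdx : inner ℝ ((signHidden δ v).vec (alignIdx m δ)) x =
    -(δ / halfSide m * ∑ j : Fin m, sgn (v j.succ) * x j.succ) := by
  simp [vec_alignIdx, inner_consVec, Finset.mul_sum, mul_assoc]
@[simp] theorem inner_vec_coneIdx (i) : inner ℝ ((signHidden δ v).vec (coneIdx δ i)) x =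
    coneScale m δ * (facet i (offset v x) + aperture m * slope δ v * x 0) := by
  have : offset v x = fun j => x j.succ + -x 0 * tilt v j := by ext j; simp only [offset]; ring
  rw [vec_coneIdx, real_inner_smul_left, inner_consVec, this, facet_add_smul, facet, facet]
  ring
@[simp] theorem inner_theta : inner ℝ (signHidden δ v).θ x = x 0 := by
  simp [signHidden, EuclideanSpace.inner_single_left]

theorem forall_known_le_iff : (∀ i : Fin (boxData m δ).K,
    inner ℝ ((boxData m δ).knownVec i) x ≤ (boxData m δ).level (Sum.inl i)) ↔ x ∈ boxSet m := by
  have h : (∀ i : Fin (boxData m δ).K, inner ℝ ((signHidden δ fun _ => true).vec (Sum.inl i)) x ≤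
      (boxData m δ).level (Sum.inl i)) ↔
      (∀ j, inner ℝ ((signHidden δ fun _ => true).vec (upperIdx δ j)) x ≤
        (boxData m δ).level (upperIdx δ j)) ∧
      ∀ j, inner ℝ ((signHidden δ fun _ => true).vec (lowerIdx δ j)) x ≤
        (boxData m δ).level (lowerIdx δ j) := forall_known
  refine h.trans ?_
  simp only [inner_vec_upperIdx, level_upperIdx, inner_vec_lowerIdx, level_lowerIdx,
    neg_le_neg_iff, boxSet, Set.mem_ofPred_eq, forall_and]
  exact and_comm

theorem knownDomain_boxData : (boxData m δ).knownDomain = boxSet m := by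
  ext x
  exact ⟨fun h => h.1, fun h => ⟨h, (forall_known_le_iff x).2 h⟩⟩

theorem isPolytopal_boxData : (boxData m δ).IsPolytopal := by
  rw [PublicData.IsPolytopal, knownDomain_boxData]
  ext x
  exact (forall_known_le_iff x).symm

theorem isBox_boxData : (boxData m δ).IsBox :=
  ⟨boxLo m, boxHi m, boxLo_lt_boxHi, knownDomain_boxData⟩

theorem norm_le_one_of_mem_boxSet {x : EuclideanSpace ℝ (Fin (m + 1))} (hx : x ∈ boxSet m) :
    ‖x‖ ≤ 1 := by
  rw [mem_boxSet] at hx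
  have h1 : ∑ j : Fin m, x j.succ ^ 2 ≤ ∑ _j : Fin m, halfSide m ^ 2 :=
    Finset.sum_le_sum fun j _ => sq_le_sq' (abs_le.1 (hx.2 j)).1 (abs_le.1 (hx.2 j)).2
  have h2 : ‖x‖ ^ 2 = x 0 ^ 2 + ∑ j : Fin m, x j.succ ^ 2 := by
    simp [EuclideanSpace.norm_sq_eq, Fin.sum_univ_succ]
  have h3 := halfSide_sq m
  simp only [Finset.sum_const, Finset.card_univ, Fintype.card_fin, nsmul_eq_mul] at h1
  have : ‖x‖ ^ 2 ≤ 1 := by nlinarith [sq_nonneg (halfSide m)]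
  exact (sq_le_one_iff₀ (norm_nonneg x)).1 this

theorem isClosed_boxSet : IsClosed (boxSet m) := by
  simp only [boxSet, Set.ofPred_forall, Set.ofPred_and]
  exact isClosed_iInter fun j => (isClosed_le (by fun_prop) (by fun_prop)).inter
    (isClosed_le (by fun_prop) (by fun_prop))

theorem isCompact_boxSet : IsCompact (boxSet m) :=
  Metric.isCompact_of_isClosed_isBounded isClosed_boxSet
    (isBounded_iff_forall_norm_le.2 ⟨1, fun _ hx => norm_le_one_of_mem_boxSet hx⟩)

theorem convex_boxSet : Convex ℝ (boxSet m) := by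
  intro x hx y hy a b ha hb hab j
  have h1 := hx j
  have h2 := hy j
  simp only [PiLp.add_apply, PiLp.smul_apply, smul_eq_mul]
  obtain rfl : b = 1 - a := by linarith
  constructor <;> nlinarith

end

/-! ### The feasible set as a pyramid with its apex at the optimum -/

variable {m : ℕ}

theorem eq_zero_of_mem_extremePoints {E : Type*} [AddCommGroup E] [Module ℝ E] {A : Set E} {x u : E}
    (hx : x ∈ A.extremePoints ℝ) (h1 : x + u ∈ A) (h2 : x - u ∈ A) : u = 0 := by
  have := hx.2 h1 h2 ⟨1 / 2, 1 / 2, by norm_num, by norm_num, by norm_num, by module⟩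
  simpa using this

section

variable {δ : ℝ} (hδ : 0 < δ) (hδ' : (m + 1) * δ ≤ 1 / 128) (v : Fin (m + 1) → Bool)
include hδ hδ'

theorem le_of_succ_mul_le : δ ≤ 1 / 128 := by
  have : (0 : ℝ) ≤ m := m.cast_nonneg
  nlinarith [mul_nonneg this hδ.le]

theorem slope_bounds : 7 / 4 ≤ slope δ v ∧ slope δ v ≤ 9 / 4 := by
  have h := le_of_succ_mul_le hδ hδ'
  have h2 := abs_le.1 (abs_sgn (v 0)).le
  unfold slope
  constructor <;> nlinarith

omit hδ' in
theorem coneScale_pos : 0 < coneScale m δ := by unfold coneScale; positivity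

/-- The optimum. -/
def optimum (δ : ℝ) (v : Fin (m + 1) → Bool) : EuclideanSpace ℝ (Fin (m + 1)) :=
  consVec (slope δ v)⁻¹ fun j => (slope δ v)⁻¹ * tilt v j

omit hδ hδ' in
theorem offset_optimum : offset v (optimum δ v) = 0 := by
  ext j; simp [offset, optimum]

/-- The inequality of a facet of the cone. -/
def InCone (δ : ℝ) (v : Fin (m + 1) → Bool) (x : EuclideanSpace ℝ (Fin (m + 1))) : Prop :=
  ∀ i, facet i (offset v x) ≤ aperture m * (1 - slope δ v * x 0)

theorem slope_mul_optimum : slope δ v * optimum δ v 0 = 1 := by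
  have := slope_bounds hδ hδ' v
  simp only [optimum, consVec_zero]
  exact mul_inv_cancel₀ (by linarith)

theorem optimum_zero_bounds : 4 / 9 ≤ optimum δ v 0 ∧ optimum δ v 0 ≤ 4 / 7 := by
  have h1 := slope_bounds hδ hδ' v
  have h2 := slope_mul_optimum hδ hδ' v
  constructor <;> nlinarith

omit hδ' in
theorem coneIdx_le_iff (i) (x : EuclideanSpace ℝ (Fin (m + 1))) :
    inner ℝ ((signHidden δ v).vec (coneIdx δ i)) x ≤ (boxData m δ).level (coneIdx δ i) ↔
      facet i (offset v x) ≤ aperture m * (1 - slope δ v * x 0) := by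
  rw [inner_vec_coneIdx, level_coneIdx, mul_le_mul_iff_right₀ (coneScale_pos hδ), mul_sub,
    mul_one, ← mul_assoc, le_sub_iff_add_le]

omit hδ' in
theorem coneIdx_eq_iff (i) (x : EuclideanSpace ℝ (Fin (m + 1))) :
    inner ℝ ((signHidden δ v).vec (coneIdx δ i)) x = (boxData m δ).level (coneIdx δ i) ↔
      facet i (offset v x) = aperture m * (1 - slope δ v * x 0) := by
  rw [inner_vec_coneIdx, level_coneIdx, mul_right_inj' (coneScale_pos hδ).ne', mul_sub,
    mul_one, ← mul_assoc, eq_sub_iff_add_eq]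

section

variable {v} {x : EuclideanSpace ℝ (Fin (m + 1))} (hx : InCone δ v x)
include hx

omit hδ hδ' in
theorem InCone.slope_mul_le : slope δ v * x 0 ≤ 1 := by
  have := nonneg_of_facet_le hx
  have := (mul_nonneg_iff_of_pos_left (aperture_pos m)).1 this
  linarith

theorem InCone.apply_zero_le : x 0 ≤ 4 / 7 := by
  have h1 := slope_bounds hδ hδ' v
  have h2 := hx.slope_mul_le
  nlinarith

theorem InCone.abs_offset_le (h0 : 1 / 4 ≤ x 0) (j : Fin m) : |offset v x j| ≤ halfSide m / 16 := by
  have h1 := slope_bounds hδ hδ' v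
  refine (abs_le_of_facet_le hx j).trans ?_
  rw [← mul_assoc, aperture_mul]
  have hs : 0 ≤ slope δ v * x 0 := mul_nonneg (by linarith) (by linarith)
  have := mul_nonneg (halfSide_pos m).le hs
  linarith

/-- For `1/4 ≤ x 0 ≤ 4/7` the aligned coordinate of the axis lies between `3/8` and `6/7` of
`halfSide m`. A displacement of at most `1/16` keeps it above the `1/4` that alignment needs on
average and strictly inside the box. -/
theorem InCone.sgn_mul_bounds (h0 : 1 / 4 ≤ x 0) (j : Fin m) :
    5 / 16 * halfSide m ≤ sgn (v j.succ) * x j.succ ∧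
      sgn (v j.succ) * x j.succ < halfSide m := by
  have h1 := abs_le.1 (hx.abs_offset_le hδ hδ' h0 j)
  have h2 := hx.apply_zero_le hδ hδ'
  have hr := halfSide_pos m
  have h3 : x j.succ = offset v x j + x 0 * tilt v j := by simp [offset]
  rw [h3, tilt]
  rcases Bool.eq_false_or_eq_true (v j.succ) with h | h <;> simp only [h, sgn] <;>
    constructor <;> simp <;> nlinarith

theorem InCone.abs_lt (h0 : 1 / 4 ≤ x 0) (j : Fin m) : |x j.succ| < halfSide m := by
  have h1 := hx.sgn_mul_bounds hδ hδ' h0 j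
  have hr := halfSide_pos m
  have : |x j.succ| = |sgn (v j.succ) * x j.succ| := by rw [abs_mul, abs_sgn, one_mul]
  rw [this, _root_.abs_lt]
  constructor <;> linarith

omit hδ' in
theorem InCone.cap_lt : inner ℝ ((signHidden δ v).vec (capIdx m δ)) x <
    (boxData m δ).level (capIdx m δ) := by
  have := hx.slope_mul_le
  simp only [inner_vec_capIdx, level_capIdx]
  linarith

theorem InCone.align_lt (h0 : 1 / 4 ≤ x 0) : inner ℝ ((signHidden δ v).vec (alignIdx m δ)) x <
    (boxData m δ).level (alignIdx m δ) := by
  have h1 : ∑ _j : Fin m, 5 / 16 * halfSide m ≤ ∑ j : Fin m, sgn (v j.succ) * x j.succ :=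
    Finset.sum_le_sum fun j _ => (hx.sgn_mul_bounds hδ hδ' h0 j).1
  have hr := halfSide_pos m
  simp only [Finset.sum_const, Finset.card_univ, Fintype.card_fin, nsmul_eq_mul] at h1
  simp only [inner_vec_alignIdx, level_alignIdx]
  have h2 : δ / halfSide m * (m * (5 / 16 * halfSide m)) = δ * (m * (5 / 16)) := by
    field_simp
  have h3 := mul_le_mul_of_nonneg_left h1 (div_pos hδ hr).le
  have : (0 : ℝ) ≤ m := m.cast_nonneg
  nlinarith [mul_nonneg hδ.le this]

end

/-- Above the base, the cone makes every constraint slack except its own facets and the base face.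
-/
theorem forall_le_iff (x : EuclideanSpace ℝ (Fin (m + 1))) :
    (∀ i, inner ℝ ((signHidden δ v).vec i) x ≤ (boxData m δ).level i) ↔
      1 / 4 ≤ x 0 ∧ InCone δ v x := by
  constructor
  · intro h
    refine ⟨?_, fun i => (coneIdx_le_iff hδ v i x).1 (h _)⟩
    have := h (lowerIdx δ 0)
    simpa [boxLo] using this
  · rintro ⟨h0, hx⟩
    have h2 := hx.apply_zero_le hδ hδ'
    have h3 := fun j => abs_lt.1 (hx.abs_lt hδ hδ' h0 j)
    rw [forall_idx]
    refine ⟨⟨Fin.forall_fin_succ.2 ⟨?_, fun j => ?_⟩, Fin.forall_fin_succ.2 ⟨?_, fun j => ?_⟩⟩,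
      (hx.cap_lt hδ).le, (hx.align_lt hδ hδ' h0).le,
      fun i => (coneIdx_le_iff hδ v i x).2 (hx i)⟩ <;>
    simp only [inner_vec_upperIdx, inner_vec_lowerIdx, level_upperIdx, level_lowerIdx, boxHi, boxLo,
      Fin.cons_zero, Fin.cons_succ]
    · linarith
    · exact (h3 j).2.le
    · linarith
    · linarith [(h3 j).1]

omit hδ hδ' in
theorem feasibleSet_signHidden : (signHidden δ v).feasibleSet =
    {x | ∀ i, inner ℝ ((signHidden δ v).vec i) x ≤ (boxData m δ).level i} := by
  ext x
  rw [Hidden.feasibleSet, knownDomain_boxData, Set.mem_ofPred_eq, Set.mem_ofPred_eq, Sum.forall,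
    ← forall_known_le_iff (δ := δ)]
  rfl

theorem mem_feasibleSet_iff (x : EuclideanSpace ℝ (Fin (m + 1))) :
    x ∈ (signHidden δ v).feasibleSet ↔ 1 / 4 ≤ x 0 ∧ InCone δ v x := by
  rw [feasibleSet_signHidden, Set.mem_ofPred_eq, forall_le_iff hδ hδ']

theorem inCone_optimum : InCone δ v (optimum δ v) := fun i => by
  rw [offset_optimum, slope_mul_optimum hδ hδ']; simp [facet]

theorem optimum_mem : optimum δ v ∈ (signHidden δ v).feasibleSet :=
  (mem_feasibleSet_iff hδ hδ' v _).2
    ⟨by linarith [(optimum_zero_bounds hδ hδ' v).1], inCone_optimum hδ hδ' v⟩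

/-- At the height of the apex the simplex cross-section shrinks to a point. -/
theorem InCone.eq_optimum {v} {x : EuclideanSpace ℝ (Fin (m + 1))} (hx : InCone δ v x)
    (h : slope δ v * x 0 = 1) : x = optimum δ v := by
  have hs := slope_bounds hδ hδ' v
  have h0 : x 0 = (slope δ v)⁻¹ := eq_inv_of_mul_eq_one_right h
  ext j
  refine Fin.cases h0 (fun j => ?_) j
  have h1 : |offset v x j| ≤ (m + 1) * (aperture m * (1 - slope δ v * x 0)) :=
    abs_le_of_facet_le hx j
  rw [h, sub_self, mul_zero, mul_zero, abs_nonpos_iff, offset, h0] at h1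
  simp only [optimum, consVec_succ]
  linarith

theorem isUniqueOptimum : (signHidden δ v).IsUniqueOptimum (optimum δ v) := by
  refine ⟨optimum_mem hδ hδ' v, fun y hy hne => ?_⟩
  rw [mem_feasibleSet_iff hδ hδ'] at hy
  have hs := slope_bounds hδ hδ' v
  have h1 := slope_mul_optimum hδ hδ' v
  have h2 := hy.2.slope_mul_le
  have h3 : slope δ v * y 0 ≠ 1 := fun h => hne (hy.2.eq_optimum hδ hδ' h)
  rw [inner_theta, inner_theta]
  have h4 := lt_of_le_of_ne h2 h3
  rw [← h1] at h4
  exact lt_of_mul_lt_mul_left h4 (by linarith)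

/-! ### Extreme points of the feasible set -/

section

variable {v} {x : EuclideanSpace ℝ (Fin (m + 1))}
  (hx : x ∈ (signHidden δ v).feasibleSet.extremePoints ℝ) (hne : x ≠ optimum δ v)
include hx hne

theorem slope_mul_lt_one : slope δ v * x 0 < 1 := by
  have h := (mem_feasibleSet_iff hδ hδ' v x).1 hx.1
  exact lt_of_le_of_ne (h.2.slope_mul_le) fun h1 => hne (h.2.eq_optimum hδ hδ' h1)

/-- The cone is homogeneous about its apex: along the line through `x` and the optimum, both the
offset and the slack `1 - slope δ v * x 0` scale by `1 + t`. A point strictly above the base can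
therefore move both ways along this line. -/
theorem apply_zero_of_mem_extremePoints : x 0 = 1 / 4 := by
  have h := (mem_feasibleSet_iff hδ hδ' v x).1 hx.1
  by_contra hx0
  have hlt : 0 < x 0 - 1 / 4 := sub_pos.2 (lt_of_le_of_ne h.1 (Ne.symm hx0))
  have hb := optimum_zero_bounds hδ hδ' v
  have hx1 := h.2.apply_zero_le hδ hδ'
  have hs1 := slope_mul_optimum hδ hδ' v
  have hso : ∀ j : Fin m, (optimum δ v) j.succ = (optimum δ v) 0 * tilt v j := fun j => by
    simp [optimum]
  have key (t : ℝ) (ht : |t| ≤ x 0 - 1 / 4) :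
      x + t • (x - optimum δ v) ∈ (signHidden δ v).feasibleSet := by
    rw [mem_feasibleSet_iff hδ hδ']
    have ht' := abs_le.1 ht
    have hcoord (j) : (x + t • (x - optimum δ v)) j = x j + t * (x j - optimum δ v j) := by
      simp
    refine ⟨?_, fun i => ?_⟩
    · rw [hcoord]
      have : |t * (x 0 - optimum δ v 0)| ≤ (x 0 - 1 / 4) * 1 := by
        rw [abs_mul]
        refine mul_le_mul ht ?_ (abs_nonneg _) hlt.le
        rw [abs_le]; constructor <;> linarith [h.1]
      linarith [(abs_le.1 this).1]
    · have e : offset v (x + t • (x - optimum δ v))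
          = fun j => (0 : Fin m → ℝ) j + (1 + t) * offset v x j := by
        ext j
        simp only [offset, hcoord, hso, Pi.zero_apply]
        ring
      rw [e, facet_add_smul, hcoord]
      have h1 := mul_le_mul_of_nonneg_left (h.2 i) (show 0 ≤ 1 + t by linarith)
      have h2 : facet i (0 : Fin m → ℝ) = 0 := by simp [facet]
      rw [h2, zero_add]
      refine h1.trans (le_of_eq ?_)
      linear_combination (-(aperture m * t)) * hs1
  have h1 := key _ (abs_of_pos hlt).le
  have h2 := key (-(x 0 - 1 / 4)) (by rw [abs_neg, abs_of_pos hlt])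
  rw [neg_smul, ← sub_eq_add_neg] at h2
  have h3 := eq_zero_of_mem_extremePoints hx h1 h2
  rcases smul_eq_zero.1 h3 with h4 | h4
  · exact hlt.ne' h4
  · exact hne (sub_eq_zero.1 h4)

omit hne in
theorem inactive_facet_unique  {p p' : Fin (m + 1)} (hp : facet p (offset v x) ≠
    aperture m * (1 - slope δ v * x 0)) (hp' : facet p' (offset v x) ≠
    aperture m * (1 - slope δ v * x 0)) : p = p' := by
  by_contra hpp
  have h := (mem_feasibleSet_iff hδ hδ' v x).1 hx.1
  set b := aperture m * (1 - slope δ v * x 0) with hb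
  -- The horizontal direction in which facet `p` rises at rate 1, facet `p'` falls at rate 1 and the
  -- others stay constant. It exists because these rates sum to zero. If `p` or `p'` is `0`, its
  -- indicator vanishes in `D` and `facet_zero` recovers the rate. Moving both ways contradicts
  -- extremality.
  set D : Fin m → ℝ := fun j =>
    (if j.succ = p then (1 : ℝ) else 0) - if j.succ = p' then 1 else 0 with hD
  have hfD (i : Fin (m + 1)) :
      facet i D = (if i = p then (1 : ℝ) else 0) - if i = p' then 1 else 0 := by
    refine Fin.cases ?_ (fun j => facet_succ j D) i
    have h1 (p : Fin (m + 1)) : (if (0 : Fin (m + 1)) = p then (1 : ℝ) else 0)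
        + ∑ j : Fin m, (if j.succ = p then (1 : ℝ) else 0) = 1 := by
      rw [← Fin.sum_univ_succ (f := fun i => if i = p then (1 : ℝ) else 0)]
      simp
    rw [facet_zero, hD, Finset.sum_sub_distrib]
    linarith [h1 p, h1 p']
  have hlp := lt_of_le_of_ne (h.2 p) hp
  have hlp' := lt_of_le_of_ne (h.2 p') hp'
  set t := min (b - facet p (offset v x)) (b - facet p' (offset v x)) with ht
  have htpos : 0 < t := lt_min (sub_pos.2 hlp) (sub_pos.2 hlp')
  have key (s : ℝ) (hs : |s| ≤ t) : x + s • consVec 0 D ∈ (signHidden δ v).feasibleSet := by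
    have hc0 : (x + s • consVec 0 D) 0 = x 0 := by simp
    rw [mem_feasibleSet_iff hδ hδ', hc0]
    refine ⟨h.1, fun i => ?_⟩
    have e : offset v (x + s • consVec 0 D) = fun j => offset v x j + s * D j := by
      ext j
      simp only [offset, hc0]
      simp only [PiLp.add_apply, PiLp.smul_apply, consVec_succ, smul_eq_mul]
      ring
    rw [e, facet_add_smul, hc0, ← hb, hfD]
    have hs' := abs_le.1 hs
    have h1 : t ≤ b - facet p (offset v x) := min_le_left _ _
    have h2 : t ≤ b - facet p' (offset v x) := min_le_right _ _
    have h3 : facet i (offset v x) ≤ b := h.2 i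
    by_cases hi : i = p
    · subst hi
      simp only [if_true, hpp, if_false]
      linarith
    · by_cases hi' : i = p'
      · subst hi'
        simp only [if_true, hi, if_false]
        linarith
      · simp only [hi, hi', if_false]
        linarith
  have h1 := key t (abs_of_pos htpos).le
  have h2 := key (-t) (by rw [abs_neg, abs_of_pos htpos])
  rw [neg_smul, ← sub_eq_add_neg] at h2
  have h3 := eq_zero_of_mem_extremePoints hx h1 h2
  rcases smul_eq_zero.1 h3 with h4 | h4
  · exact htpos.ne' h4
  · have h5 := hfD p
    have h6 : D = 0 := by
      ext j
      have := congrArg (fun w : EuclideanSpace ℝ (Fin (m + 1)) => w j.succ) h4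
      simpa using this
    rw [h6] at h5
    simp [facet, hpp] at h5

/-- Below the apex, the common right-hand side is positive while the facets sum to zero. -/
theorem exists_inactive_facet :
    ∃ p, facet p (offset v x) ≠ aperture m * (1 - slope δ v * x 0) := by
  by_contra! h
  have h1 := Finset.sum_congr rfl fun i (_ : i ∈ Finset.univ) => h i
  rw [sum_facet] at h1
  simp only [Finset.sum_const, Finset.card_univ, Fintype.card_fin, nsmul_eq_mul] at h1
  have h2 := slope_mul_lt_one hδ hδ' hx hne
  have := aperture_pos m
  have : 0 < ((m + 1 : ℕ) : ℝ) * (aperture m * (1 - slope δ v * x 0)) := by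
    have : 0 < 1 - slope δ v * x 0 := by linarith
    positivity
  linarith

end

omit hδ hδ' in
theorem coneIdx_injective : Function.Injective (coneIdx (m := m) δ) := fun _ _ h =>
  Fin.succ_injective _ (Fin.succ_injective _ (Sum.inr_injective h))

/-- The constraints that are active at a feasible point. -/
theorem active_iff {x : EuclideanSpace ℝ (Fin (m + 1))} (hx : x ∈ (signHidden δ v).feasibleSet)
    (k : (boxData m δ).Idx) :
    inner ℝ ((signHidden δ v).vec k) x = (boxData m δ).level k ↔
      (k = lowerIdx δ 0 ∧ x 0 = 1 / 4) ∨ ∃ i, k = coneIdx δ i ∧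
        facet i (offset v x) = aperture m * (1 - slope δ v * x 0) := by
  have h := (mem_feasibleSet_iff hδ hδ' v x).1 hx
  have h3 := fun j => abs_lt.1 (h.2.abs_lt hδ hδ' h.1 j)
  have h4 := h.2.apply_zero_le hδ hδ'
  constructor
  · revert k
    rw [forall_idx]
    refine ⟨⟨Fin.forall_fin_succ.2 ⟨?_, fun j => ?_⟩, Fin.forall_fin_succ.2 ⟨?_, fun j => ?_⟩⟩,
      fun hk => absurd hk (h.2.cap_lt hδ).ne, fun hk => absurd hk (h.2.align_lt hδ hδ' h.1).ne,
      fun i hk => Or.inr ⟨i, rfl, (coneIdx_eq_iff hδ v i x).1 hk⟩⟩ <;>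
    simp only [inner_vec_upperIdx, inner_vec_lowerIdx, level_upperIdx, level_lowerIdx, boxHi, boxLo,
      Fin.cons_zero, Fin.cons_succ] <;> intro hk
    · linarith
    · linarith [(h3 j).2]
    · exact Or.inl ⟨trivial, by linarith⟩
    · linarith [(h3 j).1]
  · rintro (⟨rfl, h0⟩ | ⟨i, rfl, hi⟩)
    · simp [boxLo, h0]
    · exact (coneIdx_eq_iff hδ v i x).2 hi

omit hδ hδ' in
theorem lowerIdx_ne_coneIdx (j i : Fin (m + 1)) : lowerIdx δ j ≠ coneIdx δ i := Sum.inl_ne_inr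

/-- At the apex exactly the `m + 1` cone facets are active; at any other vertex, the base face and
all cone facets but one. -/
theorem isNondegenerate : (signHidden δ v).IsNondegenerate := by
  intro x hx
  rw [← feasibleSet_signHidden] at hx
  simp only [active_iff hδ hδ' v hx.1]
  by_cases hne : x = optimum δ v
  · have h1 : {k : (boxData m δ).Idx | (k = lowerIdx δ 0 ∧ x 0 = 1 / 4) ∨ ∃ i, k = coneIdx δ i ∧
        facet i (offset v x) = aperture m * (1 - slope δ v * x 0)} = coneIdx δ '' Set.univ := by
      have hb := optimum_zero_bounds hδ hδ' v
      ext k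
      simp only [Set.mem_ofPred_eq, Set.image_univ, Set.mem_range, hne, offset_optimum,
        slope_mul_optimum hδ hδ']
      constructor
      · rintro (⟨-, h⟩ | ⟨i, rfl, -⟩)
        · linarith
        · exact ⟨i, rfl⟩
      · rintro ⟨i, rfl⟩
        exact Or.inr ⟨i, rfl, by simp [facet]⟩
    rw [h1, Set.ncard_image_of_injective _ coneIdx_injective, Set.ncard_univ]
    simp
  · have hx0 := apply_zero_of_mem_extremePoints hδ hδ' hx hne
    obtain ⟨p, hp⟩ := exists_inactive_facet hδ hδ' hx hne
    have h1 : {k : (boxData m δ).Idx | (k = lowerIdx δ 0 ∧ x 0 = 1 / 4) ∨ ∃ i, k = coneIdx δ i ∧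
        facet i (offset v x) = aperture m * (1 - slope δ v * x 0)}
        = insert (lowerIdx δ 0) (coneIdx δ '' {p}ᶜ) := by
      ext k
      simp only [Set.mem_ofPred_eq, Set.mem_insert_iff, Set.mem_image, Set.mem_compl_iff,
        Set.mem_singleton_iff]
      refine or_congr (and_iff_left hx0) ⟨?_, ?_⟩
      · rintro ⟨i, rfl, hi⟩
        exact ⟨i, fun h => hp (h ▸ hi), rfl⟩
      · rintro ⟨i, hi, rfl⟩
        refine ⟨i, rfl, ?_⟩
        by_contra h
        exact hi (inactive_facet_unique hδ hδ' hx h hp)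
    rw [h1, Set.ncard_insert_of_notMem, Set.ncard_image_of_injective _ coneIdx_injective,
      Set.ncard_compl]
    · simp
    · rintro ⟨i, -, hi⟩
      exact lowerIdx_ne_coneIdx 0 i hi.symm

end

/-- The spread of a multiple of a known constraint vector that belongs to the index set is `1`. -/
theorem Hidden.spread_smul_knownVec {d : ℕ} {P : PublicData d} (H : Hidden P) {I : Finset P.Idx}
    {x : EuclideanSpace ℝ (Fin d)} (hx : H.Associated I x) {e : Fin P.K} (he : Sum.inl e ∈ I)
    (c : ℝ) (M : Finset (Fin P.K)) : H.spread (c • P.knownVec e) I M = 1 := by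
  classical
  -- The coefficients `ρ` of known constraints in `I` are free in sign, so this candidate is
  -- feasible for every real `c`, and its `π`-part vanishes.
  have hopt : H.DualOptimal (c • P.knownVec e) I M 0 (Pi.single e c) 0 := by
    refine ⟨⟨fun _ _ => rfl, fun j hj => ?_, fun _ _ => rfl, fun _ => le_rfl, ?_⟩, ?_⟩
    · exact Pi.single_eq_of_ne (by rintro rfl; exact hj he) _
    · simp [Pi.single_apply, ite_smul]
    · rintro π ρ σ ⟨hπ, hρ, -, hσ, hv⟩
      -- Weak duality: pairing the equality constraint with the associated point `x` bounds every
      -- feasible value below by `⟨c • P.knownVec e, x⟩`, which the candidate attains.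
      have h1 := congrArg (fun w => inner ℝ w x) hv
      have hex := hx.2 _ he
      simp only [inner_add_left, sum_inner, real_inner_smul_left] at h1
      have e1 : ∑ j, π j * inner ℝ (H.unknownVec j) x = ∑ j, π j * P.level (Sum.inr j) :=
        Finset.sum_congr rfl fun j _ => by
          by_cases hj : Sum.inr j ∈ I
          · rw [← hx.2 _ hj]; rfl
          · rw [hπ j hj, zero_mul, zero_mul]
      have e2 : ∑ j, ρ j * inner ℝ (P.knownVec j) x = ∑ j, ρ j * P.level (Sum.inl j) :=
        Finset.sum_congr rfl fun j _ => by
          by_cases hj : Sum.inl j ∈ I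
          · rw [← hx.2 _ hj]; rfl
          · rw [hρ j hj, zero_mul, zero_mul]
      have e3 : ∑ j, σ j * inner ℝ (P.knownVec j) x ≤ ∑ j, σ j * P.level (Sum.inl j) :=
        Finset.sum_le_sum fun j _ => mul_le_mul_of_nonneg_left (hx.1.2 j) (hσ j)
      have e4 : P.dualValue 0 (Pi.single e c) 0 = c * P.level (Sum.inl e) := by
        simp [PublicData.dualValue, Pi.single_apply]
      change inner ℝ (P.knownVec e) x = _ at hex
      rw [e1, e2, hex] at h1
      rw [e4, PublicData.dualValue]
      linarith
  refine IsLeast.csInf_eq ⟨⟨_, _, _, hopt, by simp⟩, ?_⟩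
  rintro z ⟨π, ρ, σ, -, rfl⟩
  have : 0 ≤ ∑ j, |π j| := Finset.sum_nonneg fun _ _ => abs_nonneg _
  linarith

/-! ### Corners of the box, and the gaps at the extreme points -/

variable {m : ℕ}

/-- A vertex of the box is a corner. -/
theorem eq_or_eq_of_mem_extremePoints_boxSet {x : EuclideanSpace ℝ (Fin (m + 1))}
    (hx : x ∈ (boxSet m).extremePoints ℝ) (j : Fin (m + 1)) : x j = boxLo m j ∨ x j = boxHi m j := by
  by_contra! h
  have h1 : boxLo m j < x j := lt_of_le_of_ne (hx.1 j).1 (Ne.symm h.1)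
  have h2 : x j < boxHi m j := lt_of_le_of_ne (hx.1 j).2 h.2
  set t := min (x j - boxLo m j) (boxHi m j - x j) with ht
  have ht0 : 0 < t := lt_min (by linarith) (by linarith)
  have key (s : ℝ) (hs : |s| ≤ t) : x + EuclideanSpace.single j s ∈ boxSet m := by
    intro i
    have := abs_le.1 hs
    have h3 : t ≤ x j - boxLo m j := min_le_left _ _
    have h4 : t ≤ boxHi m j - x j := min_le_right _ _
    by_cases hij : i = j
    · subst hij
      simp only [PiLp.add_apply, PiLp.single_eq_same]
      constructor <;> linarith
    · simpa [hij] using hx.1 i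
  have h3 := key t (abs_of_pos ht0).le
  have h4 := key (-t) (by rw [abs_neg, abs_of_pos ht0])
  have h5 : EuclideanSpace.single j (-t) = -EuclideanSpace.single j t := by
    ext i; by_cases hij : i = j <;> simp [hij]
  rw [h5, ← sub_eq_add_neg] at h4
  have h6 := congrArg (fun w : EuclideanSpace ℝ (Fin (m + 1)) => w j)
    (eq_zero_of_mem_extremePoints hx h3 h4)
  simp only [PiLp.single_eq_same, PiLp.zero_apply] at h6
  exact ht0.ne' h6

section

variable {δ : ℝ} (hδ : 0 < δ) (hδ' : (m + 1) * δ ≤ 1 / 128) (v : Fin (m + 1) → Bool)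
include hδ hδ'

omit hδ hδ' in
theorem norm_theta_le : ‖(signHidden δ v).θ‖ ≤ 1 := by simp [signHidden]

theorem norm_vec_le (i : (boxData m δ).Idx) : ‖(signHidden δ v).vec i‖ ≤ 1 := by
  revert i
  have hs := slope_bounds hδ hδ' v
  have hr := halfSide_pos m
  have hr2 := halfSide_sq m
  have hm : (0 : ℝ) ≤ m := m.cast_nonneg
  rw [forall_idx]
  refine ⟨⟨fun j => ?_, fun j => ?_⟩, ?_, ?_, fun i => ?_⟩
  · rw [vec_upperIdx]; simp
  · rw [vec_lowerIdx]; simp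
  · rw [vec_capIdx]
    refine (norm_consVec_le _ _).trans ?_
    simp only [Pi.zero_apply, abs_zero, Finset.sum_const_zero, add_zero]
    rw [abs_of_nonneg (by linarith)]
    linarith
  · rw [vec_alignIdx, ← sq_le_one_iff₀ (norm_nonneg _), norm_sq_consVec]
    have : ∀ j : Fin m, (-(δ / halfSide m * sgn (v j.succ))) ^ 2 = 4 * (m + 1) * δ ^ 2 := by
      intro j
      have h1 : (-(δ / halfSide m * sgn (v j.succ))) ^ 2
          = (δ / halfSide m) ^ 2 * (sgn (v j.succ) * sgn (v j.succ)) := by ring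
      rw [h1, sgn_sq, mul_one, div_pow, div_eq_iff (by positivity)]
      linear_combination (-4 * δ ^ 2) * hr2
    simp only [this, Finset.sum_const, Finset.card_univ, Fintype.card_fin, nsmul_eq_mul]
    have h2 : 0 ≤ (m + 1) * δ := by positivity
    nlinarith [mul_nonneg hm hδ.le]
  · rw [vec_coneIdx, norm_smul, Real.norm_of_nonneg (coneScale_pos hδ).le]
    have h1 : ∑ j, |facetCoef i j| ≤ (m + 1 : ℝ) := by
      refine Fin.cases ?_ (fun k => ?_) i
      · simp [facetCoef]
      · have (j : Fin m) : |(Pi.single k (1 : ℝ) : Fin m → ℝ) j| = if j = k then 1 else 0 := by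
          rw [Pi.single_apply]; split_ifs <;> simp
        simp only [facetCoef, Fin.cons_succ, this]
        simp [hm]
    have h2 : |facet i (tilt v)| ≤ (m + 1) * (3 / 4) := by
      refine (Finset.abs_sum_le_sum_abs _ _).trans ?_
      have (j : Fin m) : |facetCoef i j * tilt v j| ≤ |facetCoef i j| * (3 / 4) := by
        rw [abs_mul, tilt, abs_mul, abs_sgn, mul_one,
          abs_of_pos (by positivity : 0 < 3 / 2 * halfSide m)]
        have := halfSide_le m
        exact mul_le_mul_of_nonneg_left (by linarith) (abs_nonneg _)
      refine (Finset.sum_le_sum fun j _ => this j).trans ?_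
      rw [← Finset.sum_mul]
      linarith
    have h3 : |aperture m * slope δ v| ≤ 1 := by
      have h4 := aperture_le m
      have h5 := halfSide_le m
      have h6 := aperture_pos m
      rw [abs_of_nonneg (mul_nonneg h6.le (by linarith))]
      nlinarith
    have h4 := norm_consVec_le (aperture m * slope δ v - facet i (tilt v)) (facetCoef i)
    have h5 := abs_sub (aperture m * slope δ v) (facet i (tilt v))
    have h6 : ‖consVec (aperture m * slope δ v - facet i (tilt v)) (facetCoef i)‖ ≤ 3 * (m + 1) := by
      linarith
    refine (mul_le_mul_of_nonneg_left h6 (coneScale_pos hδ).le).trans ?_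
    have h7 : coneScale m δ * (3 * (m + 1)) = 3 / 2 * δ := by
      unfold coneScale; field_simp
    rw [h7]
    linarith [le_of_succ_mul_le hδ hδ']

/-- The objective is minus the normal of the base face, so its spread is 1. Every associated point
has `x 0 = 1/4`, whereas the optimum has first coordinate at least `4/9`. -/
theorem effGap_ge {I : Finset (boxData m δ).Idx} {x : EuclideanSpace ℝ (Fin (m + 1))}
    (hx : (signHidden δ v).Associated I x) (hI : lowerIdx δ 0 ∈ I) :
    1 / 16 ≤ (signHidden δ v).effGap (optimum δ v) I := by
  have h1 : (signHidden δ v).θ = (-1 : ℝ) • (boxData m δ).knownVec (Fin.natAdd (m + 1) 0) := by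
    have := vec_lowerIdx (δ := δ) v 0
    change (boxData m δ).knownVec (Fin.natAdd (m + 1) 0) = _ at this
    rw [this]; simp [signHidden]
  rw [Hidden.effGap]
  conv_rhs => rw [h1, Hidden.spread_smul_knownVec _ hx hI, div_one]
  refine le_max_of_le_right (le_csInf ⟨_, x, hx, rfl⟩ ?_)
  rintro z ⟨y, hy, rfl⟩
  have h2 := hy.2 _ hI
  rw [inner_vec_lowerIdx, level_lowerIdx] at h2
  simp only [boxLo, Fin.cons_zero] at h2
  rw [← h1, inner_theta, PiLp.sub_apply]
  linarith [(optimum_zero_bounds hδ hδ' v).1]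

/-- The cap vector is a multiple of the normal of the known face `x 0 = 3/4`, so the spread is 1. On
that face the cap is violated by at least `(7/4 * 3/4 - 1 - 8/128) / 4 = 1/16`, which is the gap
constant of the theorem. -/
theorem feasGap_ge {I : Finset (boxData m δ).Idx} {x : EuclideanSpace ℝ (Fin (m + 1))}
    (hx : (signHidden δ v).Associated I x) (hI : upperIdx δ 0 ∈ I) (hcap : capIdx m δ ∉ I) :
    1 / 16 ≤ (signHidden δ v).feasGap I := by
  have h1 : -(signHidden δ v).vec (capIdx m δ)
      = (-(slope δ v / 4)) • (boxData m δ).knownVec (Fin.castAdd (m + 1) 0) := by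
    have := vec_upperIdx (δ := δ) v 0
    change (boxData m δ).knownVec (Fin.castAdd (m + 1) 0) = _ at this
    rw [this, neg_smul, vec_capIdx]
    congr 1
    ext j
    refine Fin.cases ?_ (fun j => ?_) j <;> simp
  rw [Hidden.feasGap]
  refine le_trans ?_ (le_ciSup (Set.finite_range _).bddAbove ⟨capIdx m δ, hcap⟩)
  rw [h1, Hidden.spread_smul_knownVec _ hx hI, div_one]
  refine le_csInf ⟨_, x, hx, rfl⟩ ?_
  rintro z ⟨y, hy, rfl⟩
  have h2 := hy.2 _ hI
  rw [inner_vec_upperIdx, level_upperIdx] at h2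
  simp only [boxHi, Fin.cons_zero] at h2
  rw [inner_vec_capIdx, level_capIdx, h2]
  linarith [(slope_bounds hδ hδ' v).1, le_of_succ_mul_le hδ hδ']

/-- No unknown constraint is active at a corner of the box. -/
theorem unknown_inactive {x : EuclideanSpace ℝ (Fin (m + 1))}
    (hx : x ∈ (boxSet m).extremePoints ℝ) (k : Fin (boxData m δ).U) :
    inner ℝ ((signHidden δ v).vec (Sum.inr k)) x ≠ (boxData m δ).level (Sum.inr k) := by
  have hc := eq_or_eq_of_mem_extremePoints_boxSet hx
  have hs := slope_bounds hδ hδ' v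
  have hr := halfSide_pos m
  have hd := le_of_succ_mul_le hδ hδ'
  have hx0 : x 0 = 1 / 4 ∨ x 0 = 3 / 4 := hc 0
  have hxj (j : Fin m) : ∃ σ : ℤ, x j.succ = halfSide m * σ := by
    rcases hc j.succ with h | h
    · exact ⟨-1, by rw [h]; simp [boxLo]⟩
    · exact ⟨1, by rw [h]; simp [boxHi]⟩
  have hsg (b : Bool) : ∃ s : ℤ, sgn b = s := by
    cases b
    · exact ⟨-1, by simp [sgn]⟩
    · exact ⟨1, by simp [sgn]⟩
  choose σ hσ using hxj
  choose s hs' using hsg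
  revert k
  rw [forall_unknown]
  refine ⟨?_, ?_, fun i => ?_⟩
  · change inner ℝ ((signHidden δ v).vec (capIdx m δ)) x ≠ (boxData m δ).level (capIdx m δ)
    rw [inner_vec_capIdx, level_capIdx]
    rcases hx0 with h | h <;> rw [h] <;> intro h' <;> linarith
  · change inner ℝ ((signHidden δ v).vec (alignIdx m δ)) x ≠ (boxData m δ).level (alignIdx m δ)
    rw [inner_vec_alignIdx, level_alignIdx]
    intro h
    have h1 : ∑ j : Fin m, sgn (v j.succ) * x j.succ
        = halfSide m * ((∑ j : Fin m, s (v j.succ) * σ j : ℤ) : ℝ) := by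
      push_cast
      rw [Finset.mul_sum]
      exact Finset.sum_congr rfl fun j _ => by rw [hs', hσ]; ring
    rw [h1, ← mul_assoc, div_mul_cancel₀ _ hr.ne', neg_inj] at h
    have h2 := mul_left_cancel₀ hδ.ne' h
    -- Parity: the left side is even, the right side odd.
    have h3 : (8 * (∑ j : Fin m, s (v j.succ) * σ j) : ℤ) = 2 * m - 1 := by
      have : (8 : ℝ) * ((∑ j : Fin m, s (v j.succ) * σ j : ℤ) : ℝ) = 2 * m - 1 := by
        rw [h2]; ring
      exact_mod_cast this
    omega
  · change inner ℝ ((signHidden δ v).vec (coneIdx δ i)) x ≠ (boxData m δ).level (coneIdx δ i)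
    rw [Ne, coneIdx_eq_iff hδ]
    intro h
    obtain ⟨c, hc⟩ : ∃ c : ℤ, x 0 = (2 * c + 1) / 4 := by
      rcases hx0 with h | h
      · exact ⟨0, by rw [h]; norm_num⟩
      · exact ⟨1, by rw [h]; norm_num⟩
    have hoff (j : Fin m) : offset v x j
        = halfSide m / 8 * ((8 * σ j - 3 * (2 * c + 1) * s (v j.succ) : ℤ) : ℝ) := by
      rw [offset, tilt, hs', hσ, hc]
      push_cast
      ring
    -- At a corner every facet value is an integer multiple of `halfSide m / 8`, while the
    -- right-hand side is nonzero and smaller than `aperture m ≤ halfSide m / 16` in absolute value.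
    obtain ⟨n, hn⟩ : ∃ n : ℤ, facet i (offset v x) = halfSide m / 8 * n := by
      refine Fin.cases ?_ (fun j => ?_) i
      · refine ⟨-∑ j : Fin m, (8 * σ j - 3 * (2 * c + 1) * s (v j.succ)), ?_⟩
        rw [facet_zero, Finset.sum_congr rfl fun j _ => hoff j, ← Finset.mul_sum]
        push_cast
        ring
      · exact ⟨_, (facet_succ j _).trans (hoff j)⟩
    have ha := aperture_le m
    have ha' := aperture_pos m
    have hb : |1 - slope δ v * x 0| < 1 := by
      rw [abs_lt]
      rcases hx0 with h | h <;> rw [h] <;> constructor <;> linarith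
    have hb' : 1 - slope δ v * x 0 ≠ 0 := by
      rcases hx0 with h | h <;> rw [h] <;> intro h' <;> linarith
    rw [hn] at h
    have hn0 : |(n : ℝ)| < 1 := by
      have h1 := congrArg abs h
      rw [abs_mul, abs_mul, abs_of_pos ha', abs_of_pos (by positivity : 0 < halfSide m / 8)] at h1
      by_contra! h2
      have h3 := mul_le_mul_of_nonneg_left h2 (by positivity : 0 ≤ halfSide m / 8)
      have h4 := mul_le_mul_of_nonneg_left hb.le ha'.le
      linarith
    have : n = 0 := Int.abs_lt_one_iff.1 (by exact_mod_cast hn0)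
    rw [this, Int.cast_zero, mul_zero] at h
    exact (mul_ne_zero ha'.ne' hb') h.symm

theorem extremePointGap : (signHidden δ v).ExtremePointGap (optimum δ v) (1 / 16) := by
  classical
  rintro x (hx | hx) hne I hI hIx
  · rw [knownDomain_boxData] at hx
    have hc := eq_or_eq_of_mem_extremePoints_boxSet hx
    have hcap : capIdx m δ ∉ I := fun h => unknown_inactive hδ hδ' v hx _ (hIx.2 _ h)
    by_cases hl : lowerIdx δ 0 ∈ I
    · exact le_max_of_le_left (effGap_ge hδ hδ' v hIx hl)
    by_cases hu : upperIdx δ 0 ∈ I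
    · exact le_max_of_le_right (feasGap_ge hδ hδ' v hIx hu hcap)
    exfalso
    -- Without the faces in direction `0`, only one face for each of the `m` other directions can be
    -- active, too few for a basic index set.
    have hsub : I ⊆ Finset.univ.image fun j : Fin m =>
        if x j.succ = boxHi m j.succ then upperIdx δ j.succ else lowerIdx δ j.succ := by
      intro k hk
      rw [Finset.mem_image]
      have hk' := hIx.2 k hk
      revert k
      rw [forall_idx]
      refine ⟨⟨Fin.forall_fin_succ.2 ⟨fun h => absurd h hu, fun j _ h => ?_⟩,
        Fin.forall_fin_succ.2 ⟨fun h => absurd h hl, fun j _ h => ?_⟩⟩,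
        fun h => absurd h hcap, fun _ h => absurd h (unknown_inactive hδ hδ' v hx _),
        fun i _ h => absurd h (unknown_inactive hδ hδ' v hx _)⟩
      · rw [inner_vec_upperIdx, level_upperIdx] at h
        exact ⟨j, Finset.mem_univ _, if_pos h⟩
      · rw [inner_vec_lowerIdx, level_lowerIdx, neg_inj] at h
        exact ⟨j, Finset.mem_univ _, if_neg (by rw [h]; exact (boxLo_lt_boxHi _).ne)⟩
    have h1 := (Finset.card_le_card hsub).trans Finset.card_image_le
    rw [hI, Finset.card_univ, Fintype.card_fin] at h1
    omega
  · by_cases hl : lowerIdx δ 0 ∈ I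
    · exact le_max_of_le_left (effGap_ge hδ hδ' v hIx hl)
    exfalso
    obtain ⟨p, hp⟩ := exists_inactive_facet hδ hδ' hx hne
    -- Without the base face, at most `m` cone facets remain.
    have hsub : I ⊆ (Finset.univ.erase p).image (coneIdx δ) := by
      intro k hk
      rcases (active_iff hδ hδ' v hx.1 k).1 (hIx.2 k hk) with ⟨rfl, -⟩ | ⟨i, rfl, hi⟩
      · exact absurd hk hl
      · refine Finset.mem_image_of_mem _ (Finset.mem_erase.2 ⟨?_, Finset.mem_univ _⟩)
        rintro rfl
        exact hp hi
    have h1 := (Finset.card_le_card hsub).trans Finset.card_image_le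
    rw [hI, Finset.card_erase_of_mem (Finset.mem_univ _), Finset.card_univ, Fintype.card_fin] at h1
    omega

end

/-! ### Regret of a single action -/

section

variable {d : ℕ} {P : PublicData d} (H : Hidden P)

theorem Hidden.violation_le_instRegret (xs x : EuclideanSpace ℝ (Fin d)) (i : P.Idx) :
    max (inner ℝ (H.vec i) x - P.level i) 0 ≤ H.instRegret xs x :=
  le_max_of_le_right (le_ciSup (f := fun i : P.Idx => max (inner ℝ (H.vec i) x - P.level i) 0)
    (Set.finite_range _).bddAbove i)

theorem Hidden.instRegret_nonneg (xs x : EuclideanSpace ℝ (Fin d)) : 0 ≤ H.instRegret xs x :=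
  le_max_of_le_right (Real.iSup_nonneg fun _ => le_max_right _ _)

theorem Hidden.measurable_instRegret (xs : EuclideanSpace ℝ (Fin d)) :
    Measurable (H.instRegret xs) := by
  unfold Hidden.instRegret
  refine Measurable.max (by fun_prop) (Measurable.iSup fun i => ?_)
  fun_prop

theorem Hidden.instRegret_le (hθ : ‖H.θ‖ ≤ 1) (hvec : ∀ i, ‖H.vec i‖ ≤ 1)
    {xs x : EuclideanSpace ℝ (Fin d)} (hxs : ‖xs‖ ≤ 1) (hx : ‖x‖ ≤ 1) :
    H.instRegret xs x ≤ 2 + ∑ i, |P.level i| := by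
  have h0 : 0 ≤ ∑ i, |P.level i| := Finset.sum_nonneg fun _ _ => abs_nonneg _
  have hin (a y : EuclideanSpace ℝ (Fin d)) (ha : ‖a‖ ≤ 1) : inner ℝ a y ≤ ‖y‖ :=
    (real_inner_le_norm a y).trans (mul_le_of_le_one_left (norm_nonneg y) ha)
  refine max_le ?_ (Real.iSup_le (fun i => max_le ?_ (by linarith)) (by linarith))
  · linarith [hin _ (xs - x) hθ, norm_sub_le xs x]
  · have := Finset.single_le_sum (f := fun i => |P.level i|) (fun _ _ => abs_nonneg _)
      (Finset.mem_univ i)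
    linarith [hin _ x (hvec i), neg_abs_le (P.level i)]

end

variable {m : ℕ}

/-- The correlation of an action with each of the hidden signs. -/
def score (δ : ℝ) : Fin (m + 1) → EuclideanSpace ℝ (Fin (m + 1)) → ℝ :=
  Fin.cons (fun x => max (-1) (min 1 ((1 - (2 - 32 * δ) * x 0) / (4 * δ) - 1)))
    fun j x => max (-1) (min 1 (x j.succ / halfSide m))

theorem measurable_score (δ : ℝ) (j : Fin (m + 1)) : Measurable (score δ j) := by
  refine Fin.cases ?_ (fun j => ?_) j
  · simp only [score, Fin.cons_zero]; fun_prop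
  · simp only [score, Fin.cons_succ]; fun_prop

theorem abs_score_le (δ : ℝ) (j : Fin (m + 1)) (x : EuclideanSpace ℝ (Fin (m + 1))) :
    |score δ j x| ≤ 1 := by
  refine Fin.cases ?_ (fun j => ?_) j <;> simp only [score, Fin.cons_zero, Fin.cons_succ] <;>
  exact abs_le.2 ⟨le_max_left _ _, max_le (by norm_num) (min_le_left _ _)⟩

section

variable {δ : ℝ} (hδ : 0 < δ) (hδ' : (m + 1) * δ ≤ 1 / 128) (v : Fin (m + 1) → Bool)
include hδ hδ'

/-- With `a` as below, the cap violation is at least `δ * (2 - a)` if the sign is `1`, and the lost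
reward is at least `δ * a` if it is `-1`. The two bounds add up to `2 * δ` at every action, so none
is good for both signs. The score is `a - 1`, clipped. -/
theorem score_zero_le_instRegret {x : EuclideanSpace ℝ (Fin (m + 1))} (hx : x ∈ boxSet m) :
    δ * (1 - sgn (v 0) * score δ 0 x) ≤ (signHidden δ v).instRegret (optimum δ v) x := by
  have hd := le_of_succ_mul_le hδ hδ'
  have hx0 := ((mem_boxSet.1 hx).1).1
  have h0 := (signHidden δ v).instRegret_nonneg (optimum δ v) x
  set R := (signHidden δ v).instRegret (optimum δ v) x with hR
  set a := (1 - (2 - 32 * δ) * x 0) / (4 * δ) with ha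
  have ha' : δ * a = (1 - (2 - 32 * δ) * x 0) / 4 := by rw [ha]; field_simp
  have hY : score δ 0 x = max (-1) (min 1 (a - 1)) := rfl
  rcases Bool.eq_false_or_eq_true (v 0) with hv | hv
  · have hq : slope δ v = 2 + 32 * δ := by simp [slope, hv, sgn]
    have hc := (le_max_left _ _).trans
      ((signHidden δ v).violation_le_instRegret (optimum δ v) x (capIdx m δ))
    rw [← hR, inner_vec_capIdx, level_capIdx, hq] at hc
    have hs : sgn (v 0) = 1 := by simp [hv, sgn]
    -- The cap violation equals `-δ * a + 16 * δ * x 0 - 2 * δ`, and `x 0 ≥ 1/4` on the box.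
    have hsum : δ * (2 - a) ≤ R := by nlinarith
    rw [hs, one_mul, hY]
    rcases le_total (a - 1) 1 with h1 | h1
    · rw [min_eq_right h1]
      have := le_max_right (-1) (a - 1)
      nlinarith
    · rw [min_eq_left h1, max_eq_right (by norm_num)]
      linarith
  · have hq : slope δ v = 2 - 32 * δ := by simp [slope, hv, sgn]; ring
    have hb := slope_bounds hδ hδ' v
    have hc : inner ℝ (signHidden δ v).θ (optimum δ v - x) ≤ R := le_max_left _ _
    rw [inner_theta, PiLp.sub_apply] at hc
    have hs : sgn (v 0) = -1 := by simp [hv, sgn]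
    have hso := slope_mul_optimum hδ hδ' v
    have hsum : δ * a ≤ R := by
      have h2 := mul_le_mul_of_nonneg_left hc (show 0 ≤ slope δ v by linarith)
      have h3 := mul_le_mul_of_nonneg_right hb.2 h0
      rw [ha', ← hq]
      linarith
    rw [hs, hY]
    rcases le_total (-1) (min 1 (a - 1)) with h1 | h1
    · rw [max_eq_right h1]
      have := min_le_right 1 (a - 1)
      nlinarith
    · rw [max_eq_left h1]
      linarith

/-- An action whose correlation with the hidden signs is small has large regret. -/
theorem score_le_instRegret {x : EuclideanSpace ℝ (Fin (m + 1))} (hx : x ∈ boxSet m) :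
    δ / 2 * ∑ j, (1 / 4 - sgn (v j) * score δ j x)
      ≤ (signHidden δ v).instRegret (optimum δ v) x := by
  have h1 := score_zero_le_instRegret hδ hδ' v hx
  have hr := halfSide_pos m
  have h2 := (le_max_left _ _).trans
    ((signHidden δ v).violation_le_instRegret (optimum δ v) x (alignIdx m δ))
  rw [inner_vec_alignIdx, level_alignIdx] at h2
  have h3 (j : Fin m) : score δ j.succ x = x j.succ / halfSide m := by
    have h4 : |x j.succ / halfSide m| ≤ 1 := by
      rw [abs_div, abs_of_pos hr, div_le_one hr]
      exact (mem_boxSet.1 hx).2 j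
    simp only [score, Fin.cons_succ]
    rw [min_eq_right (abs_le.1 h4).2, max_eq_right (abs_le.1 h4).1]
  have h5 : ∑ j : Fin m, (1 / 4 - sgn (v j.succ) * score δ j.succ x)
      = m / 4 - (∑ j : Fin m, sgn (v j.succ) * x j.succ) / halfSide m := by
    simp only [h3, Finset.sum_sub_distrib, Finset.sum_div, mul_div_assoc]
    simp [div_eq_mul_inv]
  rw [Fin.sum_univ_succ, h5]
  have h6 : δ / halfSide m * ∑ j : Fin m, sgn (v j.succ) * x j.succ
      = δ * ((∑ j : Fin m, sgn (v j.succ) * x j.succ) / halfSide m) := by ring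
  rw [h6] at h2
  -- Average of the two lower bounds on the regret. The constant 1 in the first exceeds the required
  -- `1/4` by more than the `1/8` missing in the second.
  nlinarith

/-- Changing one hidden sign changes the observations by little. -/
theorem sq_dist_observe_le (j : Fin (m + 1)) {x : EuclideanSpace ℝ (Fin (m + 1))}
    (hx : x ∈ boxSet m) :
    (inner ℝ (signHidden δ (Function.update v j (!v j))).θ x
        - inner ℝ (signHidden δ v).θ x) ^ 2
      + ∑ i, (inner ℝ ((signHidden δ (Function.update v j (!v j))).vec i) x
        - inner ℝ ((signHidden δ v).vec i) x) ^ 2 ≤ 150 * δ ^ 2 := by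
  set w := Function.update v j (!v j) with hw
  have hd := le_of_succ_mul_le hδ hδ'
  have hr := halfSide_pos m
  have hr2 := halfSide_le m
  obtain ⟨⟨hx0, hx0'⟩, hxj⟩ := mem_boxSet.1 hx
  have hD : |sgn (w 0) - sgn (v 0)| + ∑ k : Fin m, |sgn (w k.succ) - sgn (v k.succ)| ≤ 2 := by
    rw [← Fin.sum_univ_succ (f := fun i => |sgn (w i) - sgn (v i)|),
      Finset.sum_eq_single j]
    · simp only [hw, Function.update_self]
      cases v j <;> norm_num [sgn]
    · intro i _ hi
      simp [hw, Function.update_of_ne hi]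
    · simp
  set D0 := |sgn (w 0) - sgn (v 0)| with hD0
  set D := ∑ k : Fin m, |sgn (w k.succ) - sgn (v k.succ)| with hDdef
  have hD0n : 0 ≤ D0 := abs_nonneg _
  have hDn : 0 ≤ D := Finset.sum_nonneg fun _ _ => abs_nonneg _
  have hslope : |slope δ w - slope δ v| = 32 * δ * D0 := by
    have : slope δ w - slope δ v = 32 * δ * (sgn (w 0) - sgn (v 0)) := by simp only [slope]; ring
    rw [this, abs_mul, abs_of_pos (by positivity)]
  have hcap : (inner ℝ ((signHidden δ w).vec (capIdx m δ)) x
      - inner ℝ ((signHidden δ v).vec (capIdx m δ)) x) ^ 2 ≤ (12 * δ) ^ 2 := by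
    refine sq_le_sq.2 ?_
    rw [inner_vec_capIdx, inner_vec_capIdx, abs_of_pos (by positivity : 0 < 12 * δ)]
    have : slope δ w / 4 * x 0 - slope δ v / 4 * x 0 = (slope δ w - slope δ v) * (x 0 / 4) := by
      ring
    rw [this, abs_mul, hslope, abs_of_pos (by linarith)]
    have h1 : D0 * (x 0) ≤ 2 * (3 / 4) := mul_le_mul (by linarith) hx0' (by linarith) (by norm_num)
    nlinarith
  have halign : (inner ℝ ((signHidden δ w).vec (alignIdx m δ)) x
      - inner ℝ ((signHidden δ v).vec (alignIdx m δ)) x) ^ 2 ≤ (2 * δ) ^ 2 := by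
    refine sq_le_sq.2 ?_
    rw [inner_vec_alignIdx, inner_vec_alignIdx, abs_of_pos (by positivity : 0 < 2 * δ)]
    have : -(δ / halfSide m * ∑ k : Fin m, sgn (w k.succ) * x k.succ)
        - -(δ / halfSide m * ∑ k : Fin m, sgn (v k.succ) * x k.succ)
        = -(δ / halfSide m) * ∑ k : Fin m, (sgn (w k.succ) - sgn (v k.succ)) * x k.succ := by
      simp only [sub_mul, Finset.sum_sub_distrib]; ring
    rw [this, abs_mul, abs_neg, abs_of_pos (by positivity)]
    have h1 : |∑ k : Fin m, (sgn (w k.succ) - sgn (v k.succ)) * x k.succ| ≤ D * halfSide m := by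
      refine (Finset.abs_sum_le_sum_abs _ _).trans ?_
      rw [hDdef, Finset.sum_mul]
      refine Finset.sum_le_sum fun k _ => ?_
      rw [abs_mul]
      exact mul_le_mul_of_nonneg_left (hxj k) (abs_nonneg _)
    refine (mul_le_mul_of_nonneg_left h1 (by positivity)).trans ?_
    have h2 : δ / halfSide m * (D * halfSide m) = δ * D := by field_simp
    rw [h2]
    nlinarith
  have hcone (i : Fin (m + 1)) : (inner ℝ ((signHidden δ w).vec (coneIdx δ i)) x
      - inner ℝ ((signHidden δ v).vec (coneIdx δ i)) x) ^ 2 ≤ (coneScale m δ * 2) ^ 2 := by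
    have hη := coneScale_pos (m := m) hδ
    refine sq_le_sq.2 ?_
    rw [inner_vec_coneIdx, inner_vec_coneIdx, ← mul_sub, abs_mul, abs_mul]
    refine mul_le_mul_of_nonneg_left ?_ (abs_nonneg _)
    have hoff : offset w x = fun k => offset v x k + (-(x 0 * (3 / 2 * halfSide m))) *
        (sgn (w k.succ) - sgn (v k.succ)) := by
      ext k; simp only [offset, tilt]; ring
    have hf : |facet i fun k => sgn (w k.succ) - sgn (v k.succ)| ≤ D := by
      refine (Finset.abs_sum_le_sum_abs _ _).trans (Finset.sum_le_sum fun k _ => ?_)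
      rw [abs_mul]
      refine mul_le_of_le_one_left (abs_nonneg _) ?_
      refine Fin.cases ?_ (fun l => ?_) i
      · simp [facetCoef]
      · simp only [facetCoef, Fin.cons_succ, Pi.single_apply]
        split_ifs <;> simp
    rw [hoff, facet_add_smul]
    set F := facet i fun k => sgn (w k.succ) - sgn (v k.succ)
    have e : facet i (offset v x) + -(x 0 * (3 / 2 * halfSide m)) * F
        + aperture m * slope δ w * x 0 - (facet i (offset v x) + aperture m * slope δ v * x 0)
        = -(x 0 * (3 / 2 * halfSide m)) * F + aperture m * x 0 * (slope δ w - slope δ v) := by ring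
    have ha := aperture_pos m
    have ha' := aperture_le m
    have hc1 : x 0 * (3 / 2 * halfSide m) ≤ 1 := by nlinarith
    have hc2 : aperture m * x 0 * (32 * δ) ≤ 1 := by
      have : aperture m * x 0 ≤ 1 := by nlinarith
      have h' : 0 ≤ aperture m * x 0 := by positivity
      nlinarith
    rw [e, abs_of_pos (by norm_num : (0 : ℝ) < 2)]
    refine (abs_add_le _ _).trans ?_
    rw [abs_mul, abs_mul, abs_neg, hslope, abs_of_nonneg (by positivity : 0 ≤ aperture m * x 0),
      abs_of_nonneg (by positivity : 0 ≤ x 0 * (3 / 2 * halfSide m))]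
    have h1 : x 0 * (3 / 2 * halfSide m) * |F| ≤ 1 * D :=
      mul_le_mul hc1 hf (abs_nonneg _) (by norm_num)
    have h2 : aperture m * x 0 * (32 * δ) * D0 ≤ 1 * D0 := mul_le_mul_of_nonneg_right hc2 hD0n
    linarith
  have hknown : ∑ i : Fin (boxData m δ).K, (inner ℝ ((signHidden δ w).vec (Sum.inl i)) x
      - inner ℝ ((signHidden δ v).vec (Sum.inl i)) x) ^ 2 = 0 :=
    Finset.sum_eq_zero fun i _ => by
      change (inner ℝ ((boxData m δ).knownVec i) x - inner ℝ ((boxData m δ).knownVec i) x) ^ 2 = 0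
      simp
  have hunknown : ∑ i : Fin (boxData m δ).U, (inner ℝ ((signHidden δ w).vec (Sum.inr i)) x
      - inner ℝ ((signHidden δ v).vec (Sum.inr i)) x) ^ 2 =
      (inner ℝ ((signHidden δ w).vec (capIdx m δ)) x
        - inner ℝ ((signHidden δ v).vec (capIdx m δ)) x) ^ 2 +
      ((inner ℝ ((signHidden δ w).vec (alignIdx m δ)) x
        - inner ℝ ((signHidden δ v).vec (alignIdx m δ)) x) ^ 2 +
      ∑ i : Fin (m + 1), (inner ℝ ((signHidden δ w).vec (coneIdx δ i)) x
        - inner ℝ ((signHidden δ v).vec (coneIdx δ i)) x) ^ 2) :=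
    (Fin.sum_univ_succ (n := m + 1 + 1) _).trans (congrArg _ (Fin.sum_univ_succ (n := m + 1) _))
  have hsum := Finset.sum_le_sum fun i (_ : i ∈ Finset.univ) => hcone i
  simp only [Finset.sum_const, Finset.card_univ, Fintype.card_fin, nsmul_eq_mul] at hsum
  -- The factor `1 / (m + 1)` in `coneScale` makes all `m + 1` facets together reveal at most `δ ^
  -- 2`.
  have hscale : ((m + 1 : ℕ) : ℝ) * (coneScale m δ * 2) ^ 2 ≤ δ ^ 2 := by
    have : ((m + 1 : ℕ) : ℝ) * (coneScale m δ * 2) ^ 2 = δ ^ 2 / (m + 1) := by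
      unfold coneScale; push_cast; field_simp
    rw [this]
    exact div_le_self (sq_nonneg _) (by linarith [(m.cast_nonneg : (0 : ℝ) ≤ m)])
  rw [inner_theta, inner_theta, sub_self, Fintype.sum_sum_type, hknown, hunknown]
  -- Cap, alignment and cone contribute at most `144`, `4` and `1` times `δ ^ 2`.
  linarith [sq_nonneg δ]

end

/-! ### The lower bound -/

/-- Averaging over hidden signs: if no statistic changes much when its sign is flipped, then for
some signs the statistics correlate little with them. -/
theorem exists_signs_of_flip_le {n : ℕ} {b : ℝ} (e : (Fin n → Bool) → Fin n → ℝ)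
    (he : ∀ v j, sgn (v j) * e v j ≤ sgn (v j) * e (Function.update v j (!v j)) j + b) :
    ∃ v, n * b / 2 ≤ ∑ j, (b - sgn (v j) * e v j) := by
  by_contra! h
  have key (j : Fin n) : ∑ _v : Fin n → Bool, b / 2 ≤ ∑ v : Fin n → Bool, (b - sgn (v j) * e v j) := by
    have hinv : Function.Involutive fun v : Fin n → Bool => Function.update v j (!v j) := fun v => by
      simp
    set τ := Function.Involutive.toPerm _ hinv with hτ
    have h1 := Equiv.sum_comp τ fun v => b - sgn (v j) * e v j
    -- Each `v` is paired with its flip at `j`. By hypothesis the two terms of a pair add up to at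
    -- least `b`, so a term is at least `b / 2` on average.
    have h2 : ∑ _v : Fin n → Bool, b ≤ ∑ v : Fin n → Bool, ((b - sgn (v j) * e v j) +
        (b - sgn (τ v j) * e (τ v) j)) :=
      Finset.sum_le_sum fun v _ => by
        have h3 := he v j
        simp only [hτ, Function.Involutive.coe_toPerm, Function.update_self, sgn_not]
        linarith
    rw [Finset.sum_add_distrib, h1] at h2
    rw [← Finset.sum_div]
    linarith
  have h1 := Finset.sum_lt_sum_of_nonempty Finset.univ_nonempty fun v _ => h v
  rw [Finset.sum_comm] at h1
  have h2 := Finset.sum_le_sum fun j (_ : j ∈ Finset.univ) => key j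
  rw [Finset.sum_comm] at h2
  have h3 (v : Fin n → Bool) : ∑ _j : Fin n, b / 2 = n * b / 2 := by
    simp [mul_div_assoc]
  rw [Finset.sum_congr rfl fun v _ => h3 v] at h2
  linarith

/-- The size of the hidden signal for `T` rounds. -/
def signal (m T : ℕ) : ℝ := min (1 / √T) (1 / (m + 1)) / 128

variable {m T : ℕ}

theorem signal_pos (hT : 1 ≤ T) : 0 < signal m T := by
  have : (0 : ℝ) < T := by exact_mod_cast hT
  unfold signal
  positivity

theorem succ_mul_signal_le : (m + 1) * signal m T ≤ 1 / 128 := by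
  have h1 : min (1 / √(T : ℝ)) (1 / ((m : ℝ) + 1)) ≤ 1 / (m + 1) := min_le_right _ _
  have h2 : ((m : ℝ) + 1) * (1 / (m + 1)) = 1 := by field_simp
  have h3 := mul_le_mul_of_nonneg_left h1 (by positivity : (0 : ℝ) ≤ m + 1)
  unfold signal
  linarith

theorem mul_signal_sq_le (hT : 1 ≤ T) : T * (150 * signal m T ^ 2) ≤ 150 / 16384 := by
  have hT' : (0 : ℝ) < T := by exact_mod_cast hT
  have h1 : signal m T ≤ 1 / √(T : ℝ) / 128 := by
    unfold signal
    gcongr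
    exact min_le_left _ _
  have h2 := pow_le_pow_left₀ (signal_pos hT).le h1 2
  have h3 : (1 / √(T : ℝ) / 128) ^ 2 = 1 / T / 16384 := by
    rw [div_pow, div_pow, Real.sq_sqrt hT'.le]; norm_num
  rw [h3] at h2
  calc T * (150 * signal m T ^ 2) ≤ T * (150 * (1 / T / 16384)) := by gcongr
    _ = _ := by field_simp

theorem exp_mul_signal_le (hT : 1 ≤ T) :
    Real.exp (T * (150 * signal m T ^ 2)) ≤ 101 / 100 := by
  refine (Real.exp_le_exp.2 (mul_signal_sq_le hT)).trans ?_
  -- Uses `exp s ≤ 1 / (1 - s)` at `s = 150 / 16384`.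
  have h := Real.one_sub_le_exp_neg (150 / 16384)
  rw [Real.exp_neg] at h
  have h2 := Real.exp_pos (150 / 16384)
  have h3 := mul_le_mul_of_nonneg_right h h2.le
  rw [inv_mul_cancel₀ h2.ne'] at h3
  linarith

theorem min_le_mul_signal (hT : 1 ≤ T) :
    min (((m + 1 : ℕ) : ℝ) * √(T : ℝ)) T = 128 * (T * ((m + 1) * signal m T)) := by
  have hT' : (0 : ℝ) < T := by exact_mod_cast hT
  have hsq : √(T : ℝ) * √(T : ℝ) = T := Real.mul_self_sqrt hT'.le
  have hs : 0 < √(T : ℝ) := Real.sqrt_pos.2 hT'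
  have : 128 * (T * ((m + 1) * signal m T))
      = (T * (m + 1)) * min (1 / √(T : ℝ)) (1 / (m + 1)) := by
    unfold signal; ring
  rw [this, mul_min_of_nonneg _ _ (by positivity)]
  congr 1
  · push_cast
    rw [mul_one_div, eq_div_iff hs.ne', mul_assoc, hsq]; ring
  · field_simp

/-! ### From indistinguishable signs to expected regret -/

section

variable (hT : 1 ≤ T) (A : Algorithm (boxData m (signal m T)))
include hT

/-- The total of a score over the rounds. -/
def totalScore (A : Algorithm (boxData m (signal m T))) (v : Fin (m + 1) → Bool)
    (j : Fin (m + 1)) : ℝ :=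
  ∑ t : Fin T, ∫ h, score (signal m T) j (h t).1 ∂((signHidden (signal m T) v).law A T)

omit hT in
theorem integrable_score (v : Fin (m + 1) → Bool) (j : Fin (m + 1)) (t : Fin T) :
    Integrable (fun h => score (signal m T) j (h t).1) ((signHidden (signal m T) v).law A T) :=
  Integrable.of_bound
    ((measurable_score _ j).comp (measurable_fst.comp (measurable_pi_apply t))).aestronglyMeasurable
    1 (ae_of_all _ fun _ => abs_score_le _ _ _)

theorem totalScore_le (v : Fin (m + 1) → Bool) (j : Fin (m + 1)) :
    sgn (v j) * totalScore A v j
      ≤ sgn (v j) * totalScore A (Function.update v j (!v j)) j + T * (1 / 4) := by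
  set w := Function.update v j (!v j)
  have hδ := signal_pos (m := m) hT
  have hchi : ChiSqBound ((signHidden (signal m T) w).law A T)
      ((signHidden (signal m T) v).law A T) (ENNReal.ofReal (101 / 100)) := by
    refine (Hidden.chiSqBound_law _ _ A (κ := 150 * signal m T ^ 2) (fun x hx => ?_) T).mono
      (ENNReal.ofReal_le_ofReal (exp_mul_signal_le hT))
    rw [knownDomain_boxData] at hx
    have := sq_dist_observe_le hδ succ_mul_signal_le v j hx
    simp only [sub_sq_comm (inner ℝ _ x) (inner ℝ _ x)] at this ⊢
    exact this
  have key (t : Fin T) :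
      sgn (v j) * ∫ h, score (signal m T) j (h t).1 ∂((signHidden (signal m T) v).law A T)
      ≤ sgn (v j) * (∫ h, score (signal m T) j (h t).1 ∂((signHidden (signal m T) w).law A T))
        + 1 / 4 := by
    have hb (x) : |sgn (v j) * score (signal m T) j x| ≤ 1 := by
      rw [abs_mul, abs_sgn, one_mul]; exact abs_score_le _ _ _
    have hm := (measurable_score (m := m) (signal m T) j).comp
      (measurable_fst.comp (measurable_pi_apply (X := fun _ : Fin T =>
        (boxData m (signal m T)).Round) t))
    -- The signed score is rescaled from `[-1, 1]` to `[0, 1]`, so the shift of `1/8` becomes `1/4`.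
    have := hchi.integral_le (u := fun h => (1 + sgn (v j) * score (signal m T) j (h t).1) / 2)
      (((hm.const_mul _).const_add 1).div_const 2)
      (fun h => by linarith [(abs_le.1 (hb (h t).1)).1])
      (fun h => by linarith [(abs_le.1 (hb (h t).1)).2])
    have hi (u : Fin (m + 1) → Bool) : ∫ h, (1 + sgn (v j) * score (signal m T) j (h t).1) / 2
        ∂((signHidden (signal m T) u).law A T) = (1 + sgn (v j) *
          ∫ h, score (signal m T) j (h t).1 ∂((signHidden (signal m T) u).law A T)) / 2 := by
      rw [integral_div, integral_add (integrable_const _) ((integrable_score A u j t).const_mul _),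
        integral_const_mul]
      simp
    rw [hi, hi] at this
    linarith
  have := Finset.sum_le_sum fun t (_ : t ∈ Finset.univ) => key t
  rw [Finset.sum_add_distrib, ← Finset.mul_sum, ← Finset.mul_sum] at this
  simpa [totalScore] using this

theorem le_expectedRegret (v : Fin (m + 1) → Bool) :
    signal m T / 2 * ∑ j, (T * (1 / 4) - sgn (v j) * totalScore A v j)
      ≤ (signHidden (signal m T) v).expectedRegret (optimum (signal m T) v) A T := by
  have hδ : 0 < signal m T := signal_pos hT
  have hδ' : (m + 1) * signal m T ≤ 1 / 128 := succ_mul_signal_le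
  set H := signHidden (signal m T) v with hH
  set μ := H.law A T with hμ
  have hae : ∀ᵐ h ∂μ, ∀ t, (h t).1 ∈ boxSet m := by
    have := H.ae_law_mem_knownDomain A
      (by rw [knownDomain_boxData]; exact isClosed_boxSet.measurableSet) T
    rwa [knownDomain_boxData] at this
  have hi0 (t : Fin T) (j : Fin (m + 1)) :
      Integrable (fun h => 1 / 4 - sgn (v j) * score (signal m T) j (h t).1) μ :=
    (integrable_const _).sub ((integrable_score A v j t).const_mul _)
  have hi1 (t : Fin T) : Integrable (fun h => signal m T / 2 * ∑ j, (1 / 4 - sgn (v j) * score (signal m T) j (h t).1))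
      μ :=
    (integrable_finsetSum _ fun j _ => hi0 t j).const_mul _
  have hi2 (t : Fin T) : Integrable (fun h => H.instRegret (optimum (signal m T) v) (h t).1) μ := by
    refine Integrable.of_bound ((H.measurable_instRegret _).comp
      (measurable_fst.comp (measurable_pi_apply t))).aestronglyMeasurable
      (2 + ∑ i, |(boxData m (signal m T)).level i|) ?_
    filter_upwards [hae] with h hh
    rw [Real.norm_of_nonneg (H.instRegret_nonneg _ _)]
    refine H.instRegret_le (norm_theta_le v) (norm_vec_le hδ hδ' v)
      (norm_le_one_of_mem_boxSet ?_) (norm_le_one_of_mem_boxSet (hh t))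
    have := (optimum_mem hδ hδ' v).1
    rwa [knownDomain_boxData] at this
  have hle : ∫ h, ∑ t : Fin T, signal m T / 2 * ∑ j, (1 / 4 - sgn (v j) * score (signal m T) j (h t).1) ∂μ
      ≤ ∫ h, ∑ t : Fin T, H.instRegret (optimum (signal m T) v) (h t).1 ∂μ := by
    refine integral_mono_ae (integrable_finsetSum _ fun t _ => hi1 t)
      (integrable_finsetSum _ fun t _ => hi2 t) ?_
    filter_upwards [hae] with h hh
    exact Finset.sum_le_sum fun t _ => score_le_instRegret hδ hδ' v (hh t)
  refine le_trans (le_of_eq ?_) hle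
  rw [integral_finsetSum _ fun t _ => hi1 t]
  have h1 (t : Fin T) : ∫ h, signal m T / 2 * ∑ j, (1 / 4 - sgn (v j) * score (signal m T) j (h t).1) ∂μ
      = signal m T / 2 * ∑ j, (1 / 4 - sgn (v j) * ∫ h, score (signal m T) j (h t).1 ∂μ) := by
    rw [integral_const_mul, integral_finsetSum _ fun j _ => hi0 t j]
    congr 1
    refine Finset.sum_congr rfl fun j _ => ?_
    rw [integral_sub (integrable_const _) ((integrable_score A v j t).const_mul _),
      integral_const_mul]
    simp [hμ, hH]
  rw [Finset.sum_congr rfl fun t _ => h1 t, ← Finset.mul_sum, Finset.sum_comm]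
  congr 1
  refine Finset.sum_congr rfl fun j _ => ?_
  rw [Finset.sum_sub_distrib, ← Finset.mul_sum]
  simp [totalScore, hμ, hH]

end

end SafeBandit

end

theorem mainTheorem3 :
    ∃ g : ℝ, 0 < g ∧ ∃ c : ℝ, 0 < c ∧ ∀ d T : ℕ, 1 ≤ d → 1 ≤ T →
      ∃ P : SafeBandit.PublicData d,
        IsCompact P.X ∧ Convex ℝ P.X ∧ (∀ x ∈ P.X, ‖x‖ ≤ 1) ∧ P.IsPolytopal ∧ P.IsBox ∧
        ∀ A : SafeBandit.Algorithm P,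
          ∃ (H : SafeBandit.Hidden P) (xs : EuclideanSpace ℝ (Fin d)),
            ‖H.θ‖ ≤ 1 ∧ (∀ i, ‖H.vec i‖ ≤ 1) ∧
            H.IsUniqueOptimum xs ∧ H.IsNondegenerate ∧ H.ExtremePointGap xs g ∧
            c * min ((d : ℝ) * √(T : ℝ)) (T : ℝ) ≤ H.expectedRegret xs A T := by
  refine ⟨1 / 16, by norm_num, 1 / 2048, by norm_num, fun d T hd hT => ?_⟩
  obtain ⟨m, rfl⟩ : ∃ m, d = m + 1 := ⟨d - 1, by omega⟩
  have hδ : 0 < SafeBandit.signal m T := SafeBandit.signal_pos hT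
  have hδ' : (m + 1) * SafeBandit.signal m T ≤ 1 / 128 := SafeBandit.succ_mul_signal_le
  refine ⟨SafeBandit.boxData m (SafeBandit.signal m T), SafeBandit.isCompact_boxSet,
    SafeBandit.convex_boxSet, fun x hx => SafeBandit.norm_le_one_of_mem_boxSet hx,
    SafeBandit.isPolytopal_boxData, SafeBandit.isBox_boxData, fun A => ?_⟩
  obtain ⟨v, hv⟩ := SafeBandit.exists_signs_of_flip_le (b := T * (1 / 4))
    (SafeBandit.totalScore A) (SafeBandit.totalScore_le hT A)
  refine ⟨SafeBandit.signHidden (SafeBandit.signal m T) v,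
    SafeBandit.optimum (SafeBandit.signal m T) v, SafeBandit.norm_theta_le v,
    SafeBandit.norm_vec_le hδ hδ' v, SafeBandit.isUniqueOptimum hδ hδ' v,
    SafeBandit.isNondegenerate hδ hδ' v, SafeBandit.extremePointGap hδ hδ' v,
    le_trans ?_ (SafeBandit.le_expectedRegret hT A v)⟩
  -- The regret is at least `δ/2 * ((m + 1) * T / 8)`, where `δ` is the signal, and the minimum
  -- equals `128 * T * (m + 1) * δ`; hence the constant `1 / (16 * 128) = 1 / 2048`.
  rw [SafeBandit.min_le_mul_signal hT]
  refine le_trans (le_of_eq ?_)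
    (mul_le_mul_of_nonneg_left hv (by positivity : 0 ≤ SafeBandit.signal m T / 2))
  push_cast
  ring
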